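/- Let $n\ge 1$ and consider complex-valued functions on $\mathbb R^n$ with Lebesgue measure. Let $h_k(t)=(2^kk!\sqrt\pi)^{-1/2}H_k(t)e^{-t^2/2}$ be the $L^2(\mathbb R)$-normalized Hermite functions ($H_k$ the Hermite polynomials orthogonal with respect to $e^{-t^2}dt$), put $h_\alpha(x)=\prod_{i=1}^n h_{\alpha_i}(x_i)$ for $\alpha\in\mathbb N^n$, $\mathbb N=\{0,1,2,\dots\}$, and let $$\Pi_{n+2m}f=\sum_{|\alpha|=m}\langle f,h_\alpha\rangle_{L^2(\mathbb R^n)}\,h_\alpha,\qquad f\in L^2(\mathbb R^n),\ m\in\mathbb N,$$ be the orthogonal projection onto the eigenspace of the harmonic oscillator $-\Delta+|x|^2$ for the eigenvalue $n+2m$. For $\beta>-1$ and $k\in\mathbb N$ let $$\ell_k^\beta(r)=\Big(\frac{2\Gamma(k+1)}{\Gamma(k+\beta+1)}\Big)^{1/2}L_k^\beta(r^2)e^{-r^2/2},$$ where $L_k^\beta(t)=\sum_{i=0}^k\frac{(-1)^i\,\Gamma(k+\beta+1)}{\Gamma(i+\beta+1)\,(k-i)!\,i!}\,t^i$ is the Laguerre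 polynomial of degree $k$ and order $\beta$. **Theorem (Hecke–Bochner identity for the Hermite projections).** Let $M\in\mathbb N$, let $Y$ be a solid harmonic of degree $M$, that is, a homogeneous polynomial of degree $M$ with complex coefficients on $\mathbb R^n$ such that $\Delta Y=0$ (the zero polynomial is allowed), and let $f\in L^2(\mathbb R^n)$ be of the form $f(x)=f_0(|x|)Y(x)$ for almost every $x$. Put $\beta=\frac n2-1+M$. Then $f_0\in L^2((0,\infty),r^{2\beta+1}dr)$ if $Y\ne0$, and for every $K\in\mathbb N$ and every $x\in\mathbb R^n$ $$\Pi_{n+2(M+2K)}f(x)=\Big(\int_0^\infty f_0(r)\,\ell_K^{\beta}(r)\,r^{2\beta+1}\,dr\Big)\,\ell_K^{\beta}(|x|)\,Y(x)$$ (if $Y=0$, both sides are to be read as $0$). Moreover, $\Pi_{n+2m}f=0$ for every $m\in\mathbb N$ that is not of the form $m=M+2K$ with $K\in\mathbb N$. -/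

import Mathlib

open MeasureTheory

namespace HeckeBochner

noncomputable section

/-- The physicists' Hermite polynomial `H_k(t) = 2^{k/2} He_k(√2 t)`, where `He_k` is Mathlib's
(probabilists') Hermite polynomial. -/
def hermiteH (k : ℕ) (t : ℝ) : ℝ :=
  Real.sqrt 2 ^ k * Polynomial.aeval (Real.sqrt 2 * t) (Polynomial.hermite k)

/-- The `L²(ℝ)`-normalized Hermite function
`h_k(t) = (2^k k! √π)^{-1/2} H_k(t) e^{-t²/2}`. -/
def hermiteFun (k : ℕ) (t : ℝ) : ℝ :=
  (Real.sqrt (2 ^ k * (k.factorial : ℝ) * Real.sqrt Real.pi))⁻¹ * hermiteH k t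
    * Real.exp (-t ^ 2 / 2)

/-- The multi-dimensional Hermite function `h_α(x) = ∏ i, h_{α i}(x i)`. -/
def hermiteFunction {n : ℕ} (α : Fin n → ℕ) (x : EuclideanSpace ℝ (Fin n)) : ℝ :=
  ∏ i, hermiteFun (α i) (x i)

/-- The projection `Π_{n+2m} f = ∑_{|α| = m} ⟨f, h_α⟩ h_α`, for `f ∈ L²(ℝⁿ)`; the `h_α` are
real-valued, so no complex conjugate appears in the inner product. -/
def hermiteProjection {n : ℕ} (m : ℕ) (f : EuclideanSpace ℝ (Fin n) → ℂ)
    (x : EuclideanSpace ℝ (Fin n)) : ℂ :=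
  ∑ α ∈ Finset.piAntidiag (Finset.univ : Finset (Fin n)) m,
    (∫ y, f y * (hermiteFunction α y : ℂ)) * (hermiteFunction α x : ℂ)

/-- The Laguerre polynomial `L_k^β`, for `β > -1`:
`L_k^β(t) = ∑_{i ≤ k} (-1)^i Γ(k+β+1) / (Γ(i+β+1) (k-i)! i!) t^i`. -/
def laguerreL (β : ℝ) (k : ℕ) (t : ℝ) : ℝ :=
  ∑ i ∈ Finset.range (k + 1),
    (-1) ^ i * (Real.Gamma (k + β + 1)
      / (Real.Gamma (i + β + 1) * ((k - i).factorial : ℝ) * (i.factorial : ℝ))) * t ^ i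

/-- The Laguerre function of convolution type, for `β > -1`:
`ℓ_k^β(r) = (2 Γ(k+1) / Γ(k+β+1))^{1/2} L_k^β(r²) e^{-r²/2}`. -/
def laguerreFunction (β : ℝ) (k : ℕ) (r : ℝ) : ℝ :=
  Real.sqrt (2 * Real.Gamma (k + 1) / Real.Gamma (k + β + 1)) * laguerreL β k (r ^ 2)
    * Real.exp (-r ^ 2 / 2)

/-- The measure `r^{2β+1} dr` on `(0, ∞)`. -/
def laguerreMeasure (β : ℝ) : Measure ℝ :=
  (volume.restrict (Set.Ioi 0)).withDensity (fun r => ENNReal.ofReal (r ^ (2 * β + 1)))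

/-- The coefficient `⟨f₀, ℓ_k^β⟩` in `L²((0, ∞), r^{2β+1} dr)`; `ℓ_k^β` is real-valued. -/
def laguerreCoeff (β : ℝ) (k : ℕ) (f₀ : ℝ → ℂ) : ℂ :=
  ∫ r, f₀ r * (laguerreFunction β k r : ℂ) ∂(laguerreMeasure β)

/-- `Y` is a (complex) solid harmonic, homogeneous of degree `M`: a homogeneous polynomial of
degree `M` (possibly zero) with `∑ i, ∂²Y/∂x_i² = 0`. -/
def IsSolidHarmonic {n : ℕ} (M : ℕ) (Y : MvPolynomial (Fin n) ℂ) : Prop :=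
  Y.IsHomogeneous M ∧ ∑ i, MvPolynomial.pderiv i (MvPolynomial.pderiv i Y) = 0

/-- The value of the polynomial `Y` at the point `x ∈ ℝⁿ`. -/
def evalAt {n : ℕ} (Y : MvPolynomial (Fin n) ℂ) (x : EuclideanSpace ℝ (Fin n)) : ℂ :=
  MvPolynomial.eval (fun i => (x i : ℂ)) Y

end

end HeckeBochner

/-! Write `h_α` as a constant times `H_α(x) e^{-|x|²/2}`. In polar coordinates the coefficient of
`f₀(|x|) Y(x)` against `h_α` is a radial integral of `f₀` against the spherical mean `∫ Y(ω) H_α(rω)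
dω`, so everything rests on computing that mean. It is a polynomial in `r` whose `d`-th coefficient
`s d` pairs `Y` with the degree-`d` part of `H_α` on the sphere. The Hermite equation expresses the
Laplacian of the degree-`d+2` part as a multiple of the degree-`d` part
(`laplacian_homogeneousComponent_hermiteMv`), and Green's identity against a harmonic `Y` removes
the Laplacian (`sphereIntegral_mul_laplacian`). The resulting two-step recursion for `s` forces `s =
0` unless `|α| = M + 2K`, in which case it is the recursion of the coefficients of `L_K^β`.

Hence the coefficient is `C_α ⟨f₀, ℓ_K^β⟩` with `C_α` independent of `f₀`. Taking `f₀ = ℓ_K^β` and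
using orthonormality of the Laguerre functions identifies `C_α` as the coefficient of `ℓ_K^β(|x|)
Y(x)` itself, and also shows that this function has no coefficients with `|α| ≠ M + 2K`. Being a
polynomial times `e^{-|x|²/2}`, it is a finite combination of Hermite functions, so `∑ C_α h_α`
recovers it by algebra alone (`laguerreFunction_mul_eq_sum`); completeness in `L²` is not needed.

The integrability of `f₀` is Fubini in polar coordinates, along a ray on which `Y` does not vanish
(`memLp_radial`). -/

namespace HeckeBochner

noncomputable section

/-! ### Hermite polynomials in one variable -/

open Polynomial in
/-- The physicists' Hermite polynomials, with complex coefficients. -/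
def physHermite : ℕ → Polynomial ℂ
  | 0 => 1
  | k + 1 => 2 * X * physHermite k - derivative (physHermite k)

open Polynomial in
lemma derivative_physHermite_succ (k : ℕ) :
    derivative (physHermite (k + 1)) = 2 * ((k : ℂ[X]) + 1) * physHermite k := by
  induction k with
  | zero => simp [physHermite]
  | succ k ih =>
    have h : physHermite (k + 1 + 1) =
        2 * X * physHermite (k + 1) - derivative (physHermite (k + 1)) := rfl
    have h2 : derivative (physHermite k) = 2 * X * physHermite k - physHermite (k + 1) := by
      rw [physHermite]; ring
    rw [h, derivative_sub, derivative_mul, ih]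
    have h3 : derivative (2 * ((k : ℂ[X]) + 1) * physHermite k) =
        2 * ((k : ℂ[X]) + 1) * derivative (physHermite k) := by
      rw [derivative_mul]
      simp
    rw [h3, h2]
    simp only [derivative_mul, derivative_X, derivative_ofNat]
    push_cast
    ring

open Polynomial in
lemma derivative_physHermite (k : ℕ) :
    derivative (physHermite k) = 2 * (k : ℂ[X]) * physHermite (k - 1) := by
  cases k with
  | zero => simp [physHermite]
  | succ k => simpa using derivative_physHermite_succ k

open Polynomial in
/-- The Hermite differential equation. -/
lemma physHermite_ode (k : ℕ) :
    derivative (derivative (physHermite k)) - 2 * (X * derivative (physHermite k))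
      + 2 * (k : ℂ[X]) * physHermite k = 0 := by
  cases k with
  | zero => simp [physHermite]
  | succ k =>
    have h3 : derivative (2 * ((k : ℂ[X]) + 1) * physHermite k) =
        2 * ((k : ℂ[X]) + 1) * derivative (physHermite k) := by
      rw [derivative_mul]
      simp
    rw [derivative_physHermite_succ, h3]
    rw [physHermite]
    push_cast
    ring

-- Since `√2 · √2 = 2`, rescaling turns the recurrence of `Polynomial.hermite` into the one defining
-- `physHermite`.
open Polynomial in
lemma physHermite_eq (k : ℕ) :
    physHermite k = C ((Real.sqrt 2 : ℂ) ^ k) *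
      ((hermite k).map (Int.castRingHom ℂ)).comp (C (Real.sqrt 2 : ℂ) * X) := by
  have hs : (Real.sqrt 2 : ℂ) * Real.sqrt 2 = 2 := by
    rw [← Complex.ofReal_mul, Real.mul_self_sqrt (by norm_num)]; simp
  have hC : (C (Real.sqrt 2 : ℂ)) * C (Real.sqrt 2 : ℂ) = (2 : ℂ[X]) := by
    rw [← C_mul, hs]; rfl
  induction k with
  | zero => simp [physHermite]
  | succ k ih =>
    rw [physHermite, hermite_succ, ih]
    simp only [Polynomial.map_sub, Polynomial.map_mul, map_X, sub_comp, mul_comp, X_comp,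
      derivative_mul, derivative_C, derivative_comp, derivative_map, pow_succ, derivative_X, C_mul]
    rw [← hC]
    ring

lemma physHermite_eval (k : ℕ) (t : ℝ) : (physHermite k).eval (t : ℂ) = (hermiteH k t : ℂ) := by
  rw [physHermite_eq, hermiteH]
  push_cast
  rw [Polynomial.eval_mul, Polynomial.eval_C, Polynomial.eval_comp, Polynomial.eval_map]
  congr 1
  rw [Polynomial.aeval_def, Polynomial.eval₂_eq_sum_range, Polynomial.eval₂_eq_sum_range]
  simp

/-! ### Gaussian integration in one variable and Hermite orthogonality -/

lemma integrable_pow_mul_exp_neg_sq (k : ℕ) :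
    Integrable (fun t : ℝ => t ^ k * Real.exp (-t ^ 2)) := by
  have h := integrable_rpow_mul_exp_neg_mul_sq (b := 1) one_pos (s := k)
    (by have : (0 : ℝ) ≤ k := k.cast_nonneg
        linarith)
  simpa using h

/-- Integration of a polynomial against `exp (-t²)`. -/
def gaussIntegralOne (p : Polynomial ℂ) : ℂ := ∫ t : ℝ, p.eval (t : ℂ) * (Real.exp (-t ^ 2) : ℂ)

lemma integrable_eval_mul_exp (p : Polynomial ℂ) :
    Integrable (fun t : ℝ => p.eval (t : ℂ) * (Real.exp (-t ^ 2) : ℂ)) := by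
  induction p using Polynomial.induction_on' with
  | add p q hp hq =>
    simp only [Polynomial.eval_add, add_mul]
    exact hp.add hq
  | monomial k a =>
    have h := ((integrable_pow_mul_exp_neg_sq k).ofReal (𝕜 := ℂ)).const_mul a
    refine h.congr (.of_forall fun t => ?_)
    simp [mul_assoc]

lemma gaussIntegralOne_add (p q : Polynomial ℂ) :
    gaussIntegralOne (p + q) = gaussIntegralOne p + gaussIntegralOne q := by
  simp only [gaussIntegralOne, Polynomial.eval_add, add_mul]
  exact integral_add (integrable_eval_mul_exp p) (integrable_eval_mul_exp q)

lemma gaussIntegralOne_C_mul (a : ℂ) (p : Polynomial ℂ) :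
    gaussIntegralOne (Polynomial.C a * p) = a * gaussIntegralOne p := by
  simp only [gaussIntegralOne, Polynomial.eval_mul, Polynomial.eval_C, mul_assoc]
  exact integral_const_mul _ _

lemma gaussIntegralOne_sub (p q : Polynomial ℂ) :
    gaussIntegralOne (p - q) = gaussIntegralOne p - gaussIntegralOne q := by
  rw [eq_sub_iff_add_eq, ← gaussIntegralOne_add, sub_add_cancel]

open Polynomial in
lemma gaussIntegralOne_derivative (p : ℂ[X]) :
    gaussIntegralOne (derivative p) = gaussIntegralOne (2 * X * p) := by
  have key : gaussIntegralOne (derivative p - 2 * X * p) = 0 := by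
    refine integral_eq_zero_of_hasDerivAt_of_integrable
      (f := fun t : ℝ => p.eval (t : ℂ) * (Real.exp (-t ^ 2) : ℂ)) (fun t => ?_)
      (integrable_eval_mul_exp _) (integrable_eval_mul_exp _)
    have h1 : HasDerivAt (fun t : ℝ => p.eval (t : ℂ)) ((derivative p).eval (t : ℂ)) t :=
      (p.hasDerivAt (t : ℂ)).comp_ofReal
    have h2 : HasDerivAt (fun t : ℝ => (Real.exp (-t ^ 2) : ℂ))
        ((Real.exp (-t ^ 2) * (-(2 * t)) : ℝ) : ℂ) t := by
      refine HasDerivAt.ofReal_comp ?_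
      refine HasDerivAt.exp ?_
      convert! (hasDerivAt_pow 2 t).neg using 1
      simp
    convert! h1.mul h2 using 1
    simp only [eval_sub, eval_mul, eval_X, eval_ofNat]
    push_cast
    ring
  rw [gaussIntegralOne_sub] at key
  exact sub_eq_zero.1 key

-- Integration by parts: for the Gaussian weight, `2X - d/dt` is the adjoint of `d/dt`. Iterating
-- this gives the orthogonality relations.
open Polynomial in
lemma gaussIntegralOne_mul_physHermite_succ (q : ℂ[X]) (k : ℕ) :
    gaussIntegralOne (q * physHermite (k + 1)) = gaussIntegralOne (derivative q * physHermite k) := by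
  have h : q * physHermite (k + 1) =
      2 * X * (q * physHermite k) - derivative (q * physHermite k)
        + derivative q * physHermite k := by
    rw [physHermite, derivative_mul]; ring
  rw [h, gaussIntegralOne_add, gaussIntegralOne_sub, gaussIntegralOne_derivative, sub_self, zero_add]

lemma gaussIntegralOne_one : gaussIntegralOne 1 = (Real.sqrt Real.pi : ℂ) := by
  have h := integral_gaussian 1
  simp only [gaussIntegralOne, Polynomial.eval_one, one_mul]
  rw [integral_complex_ofReal]
  simp at h
  rw [h]

lemma gaussIntegralOne_physHermite_mul (k l : ℕ) :
    gaussIntegralOne (physHermite k * physHermite l) =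
      if k = l then (2 : ℂ) ^ k * k.factorial * Real.sqrt Real.pi else 0 := by
  induction l generalizing k with
  | zero =>
    cases k with
    | zero => simp [physHermite, gaussIntegralOne_one]
    | succ k =>
      rw [mul_comm, gaussIntegralOne_mul_physHermite_succ]
      simp [physHermite, gaussIntegralOne]
  | succ l ih =>
    rw [gaussIntegralOne_mul_physHermite_succ]
    cases k with
    | zero => simp [physHermite, gaussIntegralOne]
    | succ k =>
      have : (2 * ((k : Polynomial ℂ) + 1)) = Polynomial.C (2 * ((k : ℂ) + 1)) := by
        rw [Polynomial.C_mul]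
        simp [Polynomial.C_ofNat]
      rw [derivative_physHermite_succ, this, mul_assoc, gaussIntegralOne_C_mul, ih]
      by_cases hkl : k = l
      · simp [hkl, pow_succ, Nat.factorial_succ]
        ring
      · simp [hkl]

/-! ### Polynomials on `ℝⁿ` and products in separate variables -/

variable {n : ℕ}

lemma evalAt_add (p q : MvPolynomial (Fin n) ℂ) (x : EuclideanSpace ℝ (Fin n)) :
    evalAt (p + q) x = evalAt p x + evalAt q x := map_add _ _ _

lemma evalAt_mul (p q : MvPolynomial (Fin n) ℂ) (x : EuclideanSpace ℝ (Fin n)) :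
    evalAt (p * q) x = evalAt p x * evalAt q x := map_mul _ _ _

lemma evalAt_sum {ι : Type*} (s : Finset ι) (p : ι → MvPolynomial (Fin n) ℂ)
    (x : EuclideanSpace ℝ (Fin n)) : evalAt (∑ i ∈ s, p i) x = ∑ i ∈ s, evalAt (p i) x :=
  map_sum _ _ _

lemma evalAt_C (a : ℂ) (x : EuclideanSpace ℝ (Fin n)) : evalAt (MvPolynomial.C a) x = a :=
  MvPolynomial.eval_C _

@[fun_prop]
lemma continuous_evalAt (p : MvPolynomial (Fin n) ℂ) : Continuous (evalAt p) :=
  (MvPolynomial.continuous_eval p).comp (by fun_prop)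

lemma exp_neg_norm_sq (x : EuclideanSpace ℝ (Fin n)) :
    Real.exp (-‖x‖ ^ 2) = ∏ i, Real.exp (-(x i) ^ 2) := by
  rw [EuclideanSpace.real_norm_sq_eq, ← Finset.sum_neg_distrib, Real.exp_sum]

/-- The product of one-variable polynomials in separate variables. -/
def separated (q : Fin n → Polynomial ℂ) : MvPolynomial (Fin n) ℂ :=
  ∏ i, Polynomial.aeval (MvPolynomial.X i) (q i)

lemma evalAt_separated (q : Fin n → Polynomial ℂ) (x : EuclideanSpace ℝ (Fin n)) :
    evalAt (separated q) x = ∏ i, (q i).eval (x i : ℂ) := by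
  rw [evalAt, separated, map_prod]
  refine Finset.prod_congr rfl fun i _ => ?_
  rw [← MvPolynomial.coe_aeval_eq_eval, RingHom.coe_coe, ← Polynomial.aeval_algHom_apply]
  simp [Polynomial.aeval_def, Polynomial.eval₂_eq_eval_map]

/-- By linearity, this reduces claims about Gaussian integrals of polynomials to products, where
Fubini applies. -/
lemma monomial_eq_separated (s : Fin n →₀ ℕ) (a : ℂ) :
    MvPolynomial.monomial s a =
      MvPolynomial.C a * separated (fun i => (Polynomial.X : Polynomial ℂ) ^ (s i)) := by
  rw [MvPolynomial.monomial_eq, Finsupp.prod_fintype _ _ (by simp)]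
  simp [separated]

/-- The factor of a separated polynomial not involving the variable `i`. -/
def separatedCompl (q : Fin n → Polynomial ℂ) (i : Fin n) : MvPolynomial (Fin n) ℂ :=
  ∏ j ∈ Finset.univ.erase i, Polynomial.aeval (MvPolynomial.X j) (q j)

lemma separated_update (q : Fin n → Polynomial ℂ) (i : Fin n) (a : Polynomial ℂ) :
    separated (Function.update q i a) =
      Polynomial.aeval (MvPolynomial.X i) a * separatedCompl q i := by
  rw [separated, separatedCompl, ← Finset.mul_prod_erase _ _ (Finset.mem_univ i)]
  congr 1
  · simp
  · refine Finset.prod_congr rfl fun j hj => ?_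
    rw [Function.update_of_ne (Finset.ne_of_mem_erase hj)]

lemma separated_eq (q : Fin n → Polynomial ℂ) (i : Fin n) :
    separated q = Polynomial.aeval (MvPolynomial.X i) (q i) * separatedCompl q i := by
  rw [← separated_update, Function.update_eq_self]

lemma pderiv_separatedCompl (q : Fin n → Polynomial ℂ) (i : Fin n) :
    MvPolynomial.pderiv i (separatedCompl q i) = 0 := by
  rw [separatedCompl]
  refine Finset.prod_induction _ (fun p => MvPolynomial.pderiv i p = 0) ?_ ?_ ?_
  · intro a b ha hb
    rw [MvPolynomial.pderiv_mul, ha, hb]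
    simp
  · simp
  · intro j hj
    rw [Derivation.map_aeval, MvPolynomial.pderiv_X_of_ne (Finset.ne_of_mem_erase hj), smul_zero]

lemma pderiv_aeval_X (i : Fin n) (a : Polynomial ℂ) :
    MvPolynomial.pderiv i (Polynomial.aeval (MvPolynomial.X i : MvPolynomial (Fin n) ℂ) a) =
      Polynomial.aeval (MvPolynomial.X i) (Polynomial.derivative a) := by
  rw [Derivation.map_aeval, MvPolynomial.pderiv_X_self, smul_eq_mul, mul_one]

lemma pderiv_aeval_X_mul_separatedCompl (q : Fin n → Polynomial ℂ) (i : Fin n)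
    (a : Polynomial ℂ) :
    MvPolynomial.pderiv i (Polynomial.aeval (MvPolynomial.X i) a * separatedCompl q i) =
      Polynomial.aeval (MvPolynomial.X i) (Polynomial.derivative a) * separatedCompl q i := by
  rw [MvPolynomial.pderiv_mul, pderiv_separatedCompl, pderiv_aeval_X, mul_zero, add_zero]

/-! ### Gaussian integration in `n` variables -/

/-- Integration of a polynomial against `exp (-|x|²)`. -/
def gaussIntegral (p : MvPolynomial (Fin n) ℂ) : ℂ :=
  ∫ x : EuclideanSpace ℝ (Fin n), evalAt p x * (Real.exp (-‖x‖ ^ 2) : ℂ)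

lemma integrable_separated (q : Fin n → Polynomial ℂ) :
    Integrable (fun x : EuclideanSpace ℝ (Fin n) =>
      evalAt (separated q) x * (Real.exp (-‖x‖ ^ 2) : ℂ)) := by
  have h := Integrable.fintype_prod (μ := fun _ : Fin n => (volume : Measure ℝ))
    (f := fun i (t : ℝ) => (q i).eval (t : ℂ) * (Real.exp (-t ^ 2) : ℂ))
    (fun i => integrable_eval_mul_exp (q i))
  have h2 := ((EuclideanSpace.volume_preserving_symm_measurableEquiv_toLp (Fin n)).integrable_comp_emb
    (MeasurableEquiv.measurableEmbedding _)).2 h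
  refine h2.congr (.of_forall fun x => ?_)
  simp only [Function.comp_apply]
  rw [evalAt_separated, exp_neg_norm_sq, Complex.ofReal_prod, ← Finset.prod_mul_distrib]
  rfl

lemma gaussIntegral_separated (q : Fin n → Polynomial ℂ) :
    gaussIntegral (separated q) = ∏ i, gaussIntegralOne (q i) := by
  have h := integral_fintype_prod_volume_eq_prod
    (f := fun i (t : ℝ) => (q i).eval (t : ℂ) * (Real.exp (-t ^ 2) : ℂ))
  simp only [gaussIntegralOne]
  rw [← h, ← (EuclideanSpace.volume_preserving_symm_measurableEquiv_toLp (Fin n)).integral_comp'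
    (g := fun x : Fin n → ℝ => ∏ i, ((q i).eval (x i : ℂ) * (Real.exp (-(x i) ^ 2) : ℂ)))]
  refine integral_congr_ae (.of_forall fun x => ?_)
  simp only
  rw [evalAt_separated, exp_neg_norm_sq, Complex.ofReal_prod, ← Finset.prod_mul_distrib]
  rfl

lemma integrable_evalAt_mul_exp (p : MvPolynomial (Fin n) ℂ) :
    Integrable (fun x : EuclideanSpace ℝ (Fin n) =>
      evalAt p x * (Real.exp (-‖x‖ ^ 2) : ℂ)) := by
  induction p using MvPolynomial.induction_on' with
  | add p q hp hq =>
    simp only [evalAt_add, add_mul]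
    exact hp.add hq
  | monomial s a =>
    rw [monomial_eq_separated]
    simp only [evalAt_mul, evalAt_C, mul_assoc]
    exact (integrable_separated _).const_mul a

lemma gaussIntegral_add (p q : MvPolynomial (Fin n) ℂ) :
    gaussIntegral (p + q) = gaussIntegral p + gaussIntegral q := by
  simp only [gaussIntegral, evalAt_add, add_mul]
  exact integral_add (integrable_evalAt_mul_exp p) (integrable_evalAt_mul_exp q)

lemma gaussIntegral_C_mul (a : ℂ) (p : MvPolynomial (Fin n) ℂ) :
    gaussIntegral (MvPolynomial.C a * p) = a * gaussIntegral p := by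
  simp only [gaussIntegral, evalAt_mul, evalAt_C, mul_assoc]
  exact integral_const_mul _ _

lemma gaussIntegral_sum {ι : Type*} (s : Finset ι) (p : ι → MvPolynomial (Fin n) ℂ) :
    gaussIntegral (∑ i ∈ s, p i) = ∑ i ∈ s, gaussIntegral (p i) :=
  map_sum (AddMonoidHom.mk' gaussIntegral gaussIntegral_add) _ _

/-- On a monomial the integral factorizes, and both sides change only the `i`-th factor; there it is
one-variable integration by parts. -/
lemma gaussIntegral_pderiv (i : Fin n) (p : MvPolynomial (Fin n) ℂ) :
    gaussIntegral (MvPolynomial.pderiv i p) = 2 * gaussIntegral (MvPolynomial.X i * p) := by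
  induction p using MvPolynomial.induction_on' with
  | add p q hp hq =>
    rw [map_add, gaussIntegral_add, mul_add (MvPolynomial.X i), gaussIntegral_add, hp, hq, mul_add]
  | monomial s a =>
    rw [monomial_eq_separated, MvPolynomial.pderiv_C_mul,
      gaussIntegral_C_mul, mul_left_comm, gaussIntegral_C_mul]
    set q : Fin n → Polynomial ℂ := fun i => Polynomial.X ^ s i
    have h1 : MvPolynomial.pderiv i (separated q) =
        separated (Function.update q i (Polynomial.derivative (q i))) := by
      rw [separated_update, separated_eq q i, pderiv_aeval_X_mul_separatedCompl]
    have h2 : MvPolynomial.C 2 * (MvPolynomial.X i * separated q) =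
        separated (Function.update q i (2 * Polynomial.X * q i)) := by
      rw [separated_update, separated_eq q i, map_mul, map_mul, Polynomial.aeval_X]
      simp only [map_ofNat]
      ring
    rw [mul_left_comm, ← gaussIntegral_C_mul 2, h1, h2, gaussIntegral_separated,
      gaussIntegral_separated, ← Finset.mul_prod_erase _ _ (Finset.mem_univ i),
      ← Finset.mul_prod_erase _ _ (Finset.mem_univ i)]
    simp only [Function.update_self]
    rw [gaussIntegralOne_derivative]
    congr 2
    refine Finset.prod_congr rfl fun j hj => ?_
    rw [Function.update_of_ne (Finset.ne_of_mem_erase hj),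
      Function.update_of_ne (Finset.ne_of_mem_erase hj)]

/-! ### Hermite polynomials in `n` variables -/

/-- The polynomial part of the Hermite function `h_α`, unnormalized. -/
def hermiteMv (α : Fin n → ℕ) : MvPolynomial (Fin n) ℂ := separated fun i => physHermite (α i)

/-- The squared norm of `hermiteMv α` in `L²(exp (-|x|²))`. -/
def hermiteNormSq (α : Fin n → ℕ) : ℝ :=
  ∏ i, (2 ^ (α i) * ((α i).factorial : ℝ) * Real.sqrt Real.pi)

lemma hermiteNormSq_pos (α : Fin n → ℕ) : 0 < hermiteNormSq α :=
  Finset.prod_pos fun i _ => by positivity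

lemma separated_mul (q r : Fin n → Polynomial ℂ) :
    separated q * separated r = separated (fun i => q i * r i) := by
  simp [separated, Finset.prod_mul_distrib]

lemma gaussIntegral_hermiteMv_mul (α β : Fin n → ℕ) :
    gaussIntegral (hermiteMv α * hermiteMv β) = if α = β then (hermiteNormSq α : ℂ) else 0 := by
  rw [hermiteMv, hermiteMv, separated_mul, gaussIntegral_separated]
  simp only [gaussIntegralOne_physHermite_mul]
  split_ifs with h
  · subst h
    simp [hermiteNormSq]
  · obtain ⟨i, hi⟩ := Function.ne_iff.1 h
    exact Finset.prod_eq_zero (Finset.mem_univ i) (by simp [hi])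

lemma hermiteMv_update (α : Fin n → ℕ) (i : Fin n) (k : ℕ) :
    hermiteMv (Function.update α i k) = Polynomial.aeval (MvPolynomial.X i) (physHermite k) *
      separatedCompl (fun i => physHermite (α i)) i := by
  rw [← separated_update, hermiteMv]
  congr 1
  ext1 j
  by_cases hj : j = i
  · subst hj; simp
  · simp [hj]

/-- The three-term recurrence in the `i`-th variable. The truncated `α i - 1` is harmless at `α i =
0`, where its coefficient vanishes. -/
lemma X_mul_hermiteMv (α : Fin n → ℕ) (i : Fin n) :
    MvPolynomial.X i * hermiteMv α =
      (2⁻¹ : ℂ) • hermiteMv (Function.update α i (α i + 1)) +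
        (α i : ℂ) • hermiteMv (Function.update α i (α i - 1)) := by
  have h : (Polynomial.X : Polynomial ℂ) * physHermite (α i) =
      (2⁻¹ : ℂ) • physHermite (α i + 1) + (α i : ℂ) • physHermite (α i - 1) := by
    have h2 : (Polynomial.C (2⁻¹ : ℂ)) * 2 = 1 := by
      rw [← Polynomial.C_ofNat, ← Polynomial.C_mul]; simp
    have h3 : (Polynomial.C (α i : ℂ)) = ((α i : ℕ) : Polynomial ℂ) := by simp
    rw [physHermite, derivative_physHermite, Polynomial.smul_eq_C_mul, Polynomial.smul_eq_C_mul, h3]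
    linear_combination (-Polynomial.X * physHermite (α i)
      + (α i : Polynomial ℂ) * physHermite (α i - 1)) * h2
  rw [hermiteMv_update, hermiteMv_update]
  nth_rewrite 1 [hermiteMv]
  rw [separated_eq _ i, ← mul_assoc, ← smul_mul_assoc, ← smul_mul_assoc, ← add_mul,
    ← map_smul, ← map_smul, ← map_add, ← h, map_mul, Polynomial.aeval_X]

/-- The span contains the constants and, by the three-term recurrence, is stable under
multiplication by each variable. -/
lemma span_hermiteMv :
    Submodule.span ℂ (Set.range (hermiteMv : (Fin n → ℕ) → MvPolynomial (Fin n) ℂ)) = ⊤ := by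
  set S := Submodule.span ℂ (Set.range (hermiteMv : (Fin n → ℕ) → MvPolynomial (Fin n) ℂ))
  have hX : ∀ (i : Fin n) (p), p ∈ S → MvPolynomial.X i * p ∈ S := by
    intro i p hp
    induction hp using Submodule.span_induction with
    | mem p hp =>
      obtain ⟨α, rfl⟩ := hp
      rw [X_mul_hermiteMv]
      exact S.add_mem (S.smul_mem _ (Submodule.subset_span ⟨_, rfl⟩))
        (S.smul_mem _ (Submodule.subset_span ⟨_, rfl⟩))
    | zero => simp
    | add p q _ _ hp hq => rw [mul_add]; exact S.add_mem hp hq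
    | smul a p _ hp => rw [mul_smul_comm]; exact S.smul_mem _ hp
  refine eq_top_iff.2 fun p _ => ?_
  induction p using MvPolynomial.induction_on with
  | C a =>
    have : (MvPolynomial.C a : MvPolynomial (Fin n) ℂ) = a • hermiteMv 0 := by
      simp [hermiteMv, separated, physHermite, MvPolynomial.smul_eq_C_mul]
    rw [this]
    exact S.smul_mem _ (Submodule.subset_span ⟨_, rfl⟩)
  | add p q hp hq => exact S.add_mem (hp trivial) (hq trivial)
  | mul_X p i hp => rw [mul_comm]; exact hX i p (hp trivial)

/-- Expansion of a polynomial in the Hermite polynomials of one degree, if the other coefficients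
vanish. -/
lemma eq_sum_hermiteMv (Q : MvPolynomial (Fin n) ℂ) (m : ℕ)
    (hQ : ∀ α : Fin n → ℕ, ∑ i, α i ≠ m → gaussIntegral (Q * hermiteMv α) = 0) :
    Q = ∑ α ∈ Finset.piAntidiag (Finset.univ : Finset (Fin n)) m,
      MvPolynomial.C (gaussIntegral (Q * hermiteMv α) / hermiteNormSq α) * hermiteMv α := by
  have hmem : Q ∈ Submodule.span ℂ (Set.range (hermiteMv (n := n))) := by
    rw [span_hermiteMv]; trivial
  obtain ⟨c, hc⟩ := Finsupp.mem_span_range_iff_exists_finsupp.1 hmem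
  -- Orthogonality reads the coefficients off the finite expansion, so those outside degree `m`
  -- vanish.
  have hcoef : ∀ α, gaussIntegral (Q * hermiteMv α) = c α * hermiteNormSq α := by
    intro α
    rw [← hc, Finsupp.sum, Finset.sum_mul, gaussIntegral_sum]
    simp only [MvPolynomial.smul_eq_C_mul, mul_assoc, gaussIntegral_C_mul,
      gaussIntegral_hermiteMv_mul]
    rw [Finset.sum_eq_single α]
    · simp
    · intro β _ h; simp [h]
    · intro h; simp [Finsupp.notMem_support_iff.1 h]
  have hN : ∀ α : Fin n → ℕ, (hermiteNormSq α : ℂ) ≠ 0 := fun α =>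
    Complex.ofReal_ne_zero.2 (hermiteNormSq_pos α).ne'
  have hc' : ∀ α, gaussIntegral (Q * hermiteMv α) / hermiteNormSq α = c α := fun α => by
    rw [hcoef, mul_div_cancel_right₀ _ (hN α)]
  simp only [hc']
  nth_rewrite 1 [← hc]
  simp only [← MvPolynomial.smul_eq_C_mul]
  refine Finsupp.sum_of_support_subset _ ?_ _ (by simp)
  intro α hα
  rw [Finset.mem_piAntidiag]
  refine ⟨?_, by simp⟩
  by_contra h
  rw [Finsupp.mem_support_iff, ← hc', hQ α h, zero_div] at hα
  exact hα rfl

lemma hermiteMv_ode (α : Fin n → ℕ) :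
    ∑ i, MvPolynomial.pderiv i (MvPolynomial.pderiv i (hermiteMv α))
      - 2 * ∑ i, MvPolynomial.X i * MvPolynomial.pderiv i (hermiteMv α)
      + 2 * ((∑ i, α i : ℕ) : MvPolynomial (Fin n) ℂ) * hermiteMv α = 0 := by
  have h : ∀ i, MvPolynomial.pderiv i (MvPolynomial.pderiv i (hermiteMv α))
      - 2 * (MvPolynomial.X i * MvPolynomial.pderiv i (hermiteMv α))
      + 2 * (α i : MvPolynomial (Fin n) ℂ) * hermiteMv α = 0 := by
    intro i
    have h1 := congrArg (Polynomial.aeval (MvPolynomial.X i : MvPolynomial (Fin n) ℂ))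
      (physHermite_ode (α i))
    rw [hermiteMv, separated_eq _ i, pderiv_aeval_X_mul_separatedCompl,
      pderiv_aeval_X_mul_separatedCompl]
    simp only [map_add, map_sub, map_mul, map_ofNat, map_natCast, map_zero,
      Polynomial.aeval_X] at h1
    linear_combination separatedCompl (fun i => physHermite (α i)) i * h1
  have h2 := Finset.sum_eq_zero fun i (_ : i ∈ Finset.univ) => h i
  rw [Finset.sum_add_distrib, Finset.sum_sub_distrib, ← Finset.mul_sum, ← Finset.sum_mul,
    ← Finset.mul_sum] at h2
  exact_mod_cast h2

lemma hermiteFunction_eq (α : Fin n → ℕ) (x : EuclideanSpace ℝ (Fin n)) :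
    (hermiteFunction α x : ℂ) = ((Real.sqrt (hermiteNormSq α))⁻¹ : ℝ) * evalAt (hermiteMv α) x *
      (Real.exp (-‖x‖ ^ 2 / 2) : ℂ) := by
  have h : Real.exp (-‖x‖ ^ 2 / 2) = ∏ i, Real.exp (-(x i) ^ 2 / 2) := by
    rw [EuclideanSpace.real_norm_sq_eq, ← Finset.sum_neg_distrib, Finset.sum_div, Real.exp_sum]
  have h2 : (Real.sqrt (hermiteNormSq α))⁻¹ =
      ∏ i, (Real.sqrt (2 ^ α i * ((α i).factorial : ℝ) * Real.sqrt Real.pi))⁻¹ := by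
    rw [hermiteNormSq, Real.sqrt_prod _ (fun i _ => by positivity), Finset.prod_inv_distrib]
  rw [hermiteMv, evalAt_separated, h, h2, hermiteFunction]
  simp only [physHermite_eval, hermiteFun, Finset.prod_mul_distrib, Complex.ofReal_mul,
    Complex.ofReal_prod]

/-! ### Polar coordinates -/

section Polar

variable {E : Type*} [NormedAddCommGroup E] [NormedSpace ℝ E] [MeasurableSpace E] [BorelSpace E]
  [FiniteDimensional ℝ E] [Nontrivial E] (μ : Measure E) [μ.IsAddHaarMeasure]

open Set Metric Module

lemma measurePreserving_polar :
    MeasurePreserving (fun p : sphere (0 : E) 1 × Ioi (0 : ℝ) => (p.2 : ℝ) • (p.1 : E))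
      (μ.toSphere.prod (.volumeIoiPow (finrank ℝ E - 1))) μ := by
  have h1 := (MeasurePreserving.symm (homeomorphUnitSphereProd E).toMeasurableEquiv
    μ.measurePreserving_homeomorphUnitSphereProd)
  have h2 : MeasurePreserving (Subtype.val : ({0}ᶜ : Set E) → E) (μ.comap (↑)) μ := by
    have h3 := measurePreserving_subtype_coe (μa := μ) (measurableSet_singleton (0 : E)).compl
    rwa [restrict_compl_singleton] at h3
  exact h2.comp h1

lemma integrable_polar {F : E → ℂ} (hF : Integrable F μ) :
    Integrable (fun p : sphere (0 : E) 1 × Ioi (0 : ℝ) => F ((p.2 : ℝ) • (p.1 : E)))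
      (μ.toSphere.prod (.volumeIoiPow (finrank ℝ E - 1))) :=
  (measurePreserving_polar μ).integrable_comp_of_integrable hF

lemma integral_polar {F : E → ℂ} (hF : AEStronglyMeasurable F μ) :
    ∫ p : sphere (0 : E) 1 × Ioi (0 : ℝ), F ((p.2 : ℝ) • (p.1 : E))
      ∂(μ.toSphere.prod (.volumeIoiPow (finrank ℝ E - 1))) = ∫ x, F x ∂μ := by
  have h := measurePreserving_polar μ
  have h2 := integral_map h.measurable.aemeasurable (f := F) (by rwa [h.map_eq])
  rw [← h2, h.map_eq]

lemma integral_volumeIoiPow (k : ℕ) (F : ℝ → ℂ) :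
    ∫ r : Ioi (0 : ℝ), F r ∂(Measure.volumeIoiPow k) =
      ∫ r in Ioi (0 : ℝ), ((r ^ k : ℝ) : ℂ) * F r := by
  simp only [Measure.volumeIoiPow, ENNReal.ofReal]
  rw [integral_withDensity_eq_integral_smul (by fun_prop),
    integral_subtype_comap measurableSet_Ioi fun a : ℝ => Real.toNNReal (a ^ k) • F a]
  refine setIntegral_congr_fun measurableSet_Ioi fun r hr => ?_
  rw [NNReal.smul_def, Real.coe_toNNReal _ (pow_nonneg (le_of_lt hr) _), Complex.real_smul]

end Polar

/-! ### Integration over the sphere and Green's identity -/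

lemma evalAt_smul {q : MvPolynomial (Fin n) ℂ} {d : ℕ} (hq : q.IsHomogeneous d) (r : ℝ)
    (x : EuclideanSpace ℝ (Fin n)) : evalAt q (r • x) = (r : ℂ) ^ d * evalAt q x := by
  simp only [evalAt, MvPolynomial.eval_eq', Finset.mul_sum]
  refine Finset.sum_congr rfl fun s hs => ?_
  rw [hq.degree_eq_sum_deg_support hs, ← Finsupp.degree_apply, Finsupp.degree_eq_sum]
  simp only [PiLp.smul_apply, smul_eq_mul, Complex.ofReal_mul, mul_pow, Finset.prod_mul_distrib,
    Finset.prod_pow_eq_pow_sum]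
  ring

/-- Integration of a polynomial over the unit sphere. -/
def sphereIntegral (q : MvPolynomial (Fin n) ℂ) : ℂ :=
  ∫ ω : Metric.sphere (0 : EuclideanSpace ℝ (Fin n)) 1, evalAt q ω
    ∂(volume : Measure (EuclideanSpace ℝ (Fin n))).toSphere

lemma integrable_sphere {F : EuclideanSpace ℝ (Fin n) → ℂ} (hF : Continuous F) :
    Integrable (fun ω : Metric.sphere (0 : EuclideanSpace ℝ (Fin n)) 1 => F ω)
      (volume : Measure (EuclideanSpace ℝ (Fin n))).toSphere :=
  (hF.comp continuous_subtype_val).integrable_of_hasCompactSupport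
    (HasCompactSupport.of_compactSpace _)

/-- Homogeneity splits off the radial integral `∫ r^{d+n-1} e^{-r²} dr`. Integration by parts can
thus be done with the Gaussian weight and then transferred to the sphere. -/
lemma gaussIntegral_eq_sphereIntegral [NeZero n] {q : MvPolynomial (Fin n) ℂ} {d : ℕ}
    (hq : q.IsHomogeneous d) :
    gaussIntegral q = sphereIntegral q * ((Real.Gamma ((d + n : ℝ) / 2) / 2 : ℝ) : ℂ) := by
  have hn : 1 ≤ n := Nat.one_le_iff_ne_zero.2 (NeZero.ne n)
  rw [gaussIntegral, ← integral_polar volume (integrable_evalAt_mul_exp q).aestronglyMeasurable]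
  simp only [evalAt_smul hq]
  have h : ∀ p : Metric.sphere (0 : EuclideanSpace ℝ (Fin n)) 1 × Set.Ioi (0 : ℝ),
      (((p.2 : ℝ) : ℂ) ^ d * evalAt q p.1) *
        (Real.exp (-‖(p.2 : ℝ) • (p.1 : EuclideanSpace ℝ (Fin n))‖ ^ 2) : ℂ) =
      evalAt q p.1 * (fun r : ℝ => ((r ^ d * Real.exp (-r ^ 2) : ℝ) : ℂ)) p.2 := by
    intro p
    rw [norm_smul, norm_eq_of_mem_sphere, mul_one, Real.norm_eq_abs, sq_abs]
    push_cast
    ring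
  simp only [h]
  rw [integral_prod_mul (fun ω : Metric.sphere (0 : EuclideanSpace ℝ (Fin n)) 1 => evalAt q ω)
      (fun r : Set.Ioi (0 : ℝ) => (fun r : ℝ => ((r ^ d * Real.exp (-r ^ 2) : ℝ) : ℂ)) r),
    integral_volumeIoiPow _ (fun r : ℝ => ((r ^ d * Real.exp (-r ^ 2) : ℝ) : ℂ)), sphereIntegral]
  congr 1
  rw [finrank_euclideanSpace_fin]
  simp only [← Complex.ofReal_mul]
  rw [integral_complex_ofReal]
  congr 1
  have h2 := integral_rpow_mul_exp_neg_rpow (p := 2) (q := ((d + (n - 1) : ℕ) : ℝ)) two_pos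
    (by have := Nat.cast_nonneg (α := ℝ) (d + (n - 1))
        linarith)
  have h3 : (((d + (n - 1) : ℕ) : ℝ) + 1) / 2 = (d + n : ℝ) / 2 := by
    push_cast [Nat.cast_sub hn]
    ring
  rw [h3] at h2
  rw [div_eq_inv_mul (Real.Gamma _), ← one_div, ← h2]
  refine setIntegral_congr_fun measurableSet_Ioi fun r _ => ?_
  simp only [Real.rpow_natCast, Real.rpow_two, pow_add]
  ring

lemma sphereIntegral_C_mul (a : ℂ) (p : MvPolynomial (Fin n) ℂ) :
    sphereIntegral (MvPolynomial.C a * p) = a * sphereIntegral p := by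
  simp only [sphereIntegral, evalAt_mul, evalAt_C]
  exact integral_const_mul _ _

/-- Integrate the divergence of `p ∇q` by parts; Euler's identity evaluates the resulting `x · ∇q`
as `d q`. -/
lemma gaussIntegral_grad_add {p q : MvPolynomial (Fin n) ℂ} {d : ℕ} (hq : q.IsHomogeneous d) :
    gaussIntegral (∑ i, MvPolynomial.pderiv i p * MvPolynomial.pderiv i q) +
      gaussIntegral (p * ∑ i, MvPolynomial.pderiv i (MvPolynomial.pderiv i q)) =
      2 * d * gaussIntegral (p * q) := by
  have h : ∀ i, gaussIntegral (MvPolynomial.pderiv i p * MvPolynomial.pderiv i q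
      + p * MvPolynomial.pderiv i (MvPolynomial.pderiv i q)) =
      2 * gaussIntegral (p * (MvPolynomial.X i * MvPolynomial.pderiv i q)) := by
    intro i
    rw [← MvPolynomial.pderiv_mul, gaussIntegral_pderiv]
    congr 2
    ring
  have h2 := Finset.sum_congr rfl fun i (_ : i ∈ Finset.univ) => h i
  rw [← gaussIntegral_sum, ← Finset.mul_sum, ← gaussIntegral_sum, Finset.sum_add_distrib,
    gaussIntegral_add, ← Finset.mul_sum, ← Finset.mul_sum, hq.sum_X_mul_pderiv] at h2
  rw [h2, nsmul_eq_mul, mul_left_comm, ← map_natCast MvPolynomial.C, gaussIntegral_C_mul]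
  ring

/-- Green's identity with the Gaussian weight. -/
lemma gaussIntegral_mul_laplacian {Y q : MvPolynomial (Fin n) ℂ} {M d : ℕ}
    (hY : IsSolidHarmonic M Y) (hq : q.IsHomogeneous d) :
    gaussIntegral (Y * ∑ i, MvPolynomial.pderiv i (MvPolynomial.pderiv i q)) =
      2 * ((d : ℂ) - M) * gaussIntegral (Y * q) := by
  -- Use the identity with both assignments of roles to `Y` and `q`: the gradient terms cancel in
  -- the difference, and `ΔY = 0`.
  have h1 := gaussIntegral_grad_add (p := Y) hq
  have h2 := gaussIntegral_grad_add (p := q) hY.1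
  have h0 : gaussIntegral (0 : MvPolynomial (Fin n) ℂ) = 0 := by simp [gaussIntegral, evalAt]
  rw [hY.2, mul_zero, h0, add_zero, mul_comm q Y] at h2
  simp only [mul_comm (MvPolynomial.pderiv _ q)] at h2
  linear_combination h1 - h2

lemma isHomogeneous_laplacian {q : MvPolynomial (Fin n) ℂ} {d : ℕ} (hq : q.IsHomogeneous (d + 2)) :
    (∑ i, MvPolynomial.pderiv i (MvPolynomial.pderiv i q)).IsHomogeneous d :=
  MvPolynomial.IsHomogeneous.sum _ _ _ fun _ _ => hq.pderiv.pderiv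

/-- The integrands have degrees `M + d` and `M + d + 2`, so their Gamma factors differ by `(M + d +
n) / 2`. -/
lemma sphereIntegral_mul_laplacian [NeZero n] {Y q : MvPolynomial (Fin n) ℂ} {M d : ℕ}
    (hY : IsSolidHarmonic M Y) (hq : q.IsHomogeneous (d + 2)) :
    sphereIntegral (Y * ∑ i, MvPolynomial.pderiv i (MvPolynomial.pderiv i q)) =
      ((d : ℂ) + 2 - M) * (M + d + n) * sphereIntegral (Y * q) := by
  have h := gaussIntegral_mul_laplacian hY hq
  rw [gaussIntegral_eq_sphereIntegral (hY.1.mul hq),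
    gaussIntegral_eq_sphereIntegral (hY.1.mul (isHomogeneous_laplacian hq))] at h
  have hn : (0 : ℝ) < n := Nat.cast_pos.2 (Nat.pos_of_ne_zero (NeZero.ne n))
  have hz : (0 : ℝ) < (((M + d : ℕ) : ℝ) + n) / 2 := by positivity
  have hG : (((M + (d + 2) : ℕ) : ℝ) + n) / 2 = (((M + d : ℕ) : ℝ) + n) / 2 + 1 := by
    push_cast; ring
  rw [hG, Real.Gamma_add_one hz.ne'] at h
  have hG0 : ((Real.Gamma ((((M + d : ℕ) : ℝ) + n) / 2) / 2 : ℝ) : ℂ) ≠ 0 :=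
    Complex.ofReal_ne_zero.2 (div_pos (Real.Gamma_pos_of_pos hz) two_pos).ne'
  refine mul_right_cancel₀ hG0 (h.trans ?_)
  push_cast
  ring

lemma pderiv_pderiv_of_isHomogeneous_lt {q : MvPolynomial (Fin n) ℂ} {d : ℕ}
    (hq : q.IsHomogeneous d) (hd : d < 2) (i : Fin n) :
    MvPolynomial.pderiv i (MvPolynomial.pderiv i q) = 0 := by
  have h : (MvPolynomial.pderiv i q).IsHomogeneous 0 := by
    have := hq.pderiv (i := i)
    rwa [show d - 1 = 0 by omega] at this
  rw [MvPolynomial.totalDegree_eq_zero_iff_eq_C.1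
    ((MvPolynomial.totalDegree_zero_iff_isHomogeneous _).2 h), MvPolynomial.pderiv_C]

/-- In degree below two the Laplacian of `q` vanishes, so Green's identity leaves a nonzero multiple
of `d - M`. This supplies the initial values of the recursion. -/
lemma sphereIntegral_mul_eq_zero [NeZero n] {Y q : MvPolynomial (Fin n) ℂ} {M d : ℕ}
    (hY : IsSolidHarmonic M Y) (hq : q.IsHomogeneous d) (hd : d < 2) (hdM : d ≠ M) :
    sphereIntegral (Y * q) = 0 := by
  have h := gaussIntegral_mul_laplacian hY hq
  simp only [pderiv_pderiv_of_isHomogeneous_lt hq hd, Finset.sum_const_zero, mul_zero] at h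
  have h0 : gaussIntegral (0 : MvPolynomial (Fin n) ℂ) = 0 := by simp [gaussIntegral, evalAt]
  have hdM' : (d : ℂ) - M ≠ 0 := sub_ne_zero.2 (Nat.cast_injective.ne hdM)
  rw [h0, gaussIntegral_eq_sphereIntegral (hY.1.mul hq)] at h
  have hn : (0 : ℝ) < n := Nat.cast_pos.2 (Nat.pos_of_ne_zero (NeZero.ne n))
  have hz : (0 : ℝ) < (((M + d : ℕ) : ℝ) + n) / 2 := by positivity
  have hG0 : ((Real.Gamma ((((M + d : ℕ) : ℝ) + n) / 2) / 2 : ℝ) : ℂ) ≠ 0 :=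
    Complex.ofReal_ne_zero.2 (div_pos (Real.Gamma_pos_of_pos hz) two_pos).ne'
  have h2 := h.symm
  simpa only [mul_eq_zero, hdM', hG0, two_ne_zero, false_or, or_false] using h2

/-! ### Homogeneous components of the Hermite equation -/

lemma homogeneousComponent_pderiv (i : Fin n) (d : ℕ) (p : MvPolynomial (Fin n) ℂ) :
    MvPolynomial.homogeneousComponent d (MvPolynomial.pderiv i p) =
      MvPolynomial.pderiv i (MvPolynomial.homogeneousComponent (d + 1) p) := by
  ext s
  rw [MvPolynomial.coeff_homogeneousComponent, MvPolynomial.coeff_pderiv,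
    MvPolynomial.coeff_pderiv, MvPolynomial.coeff_homogeneousComponent, map_add,
    Finsupp.degree_single]
  by_cases h : s.degree = d <;> simp [h]

lemma homogeneousComponent_euler (d : ℕ) (p : MvPolynomial (Fin n) ℂ) :
    MvPolynomial.homogeneousComponent d (∑ i, MvPolynomial.X i * MvPolynomial.pderiv i p) =
      (d : MvPolynomial (Fin n) ℂ) * MvPolynomial.homogeneousComponent d p := by
  have h : ∀ e, ∑ i, MvPolynomial.X i *
      MvPolynomial.pderiv i (MvPolynomial.homogeneousComponent e p) =
      MvPolynomial.C (e : ℂ) * MvPolynomial.homogeneousComponent e p := fun e => by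
    rw [(MvPolynomial.homogeneousComponent_isHomogeneous e p).sum_X_mul_pderiv, nsmul_eq_mul,
      map_natCast]
  have h2 : ∑ i, MvPolynomial.X i * MvPolynomial.pderiv i p =
      ∑ e ∈ Finset.range (p.totalDegree + 1),
        MvPolynomial.C (e : ℂ) * MvPolynomial.homogeneousComponent e p := by
    nth_rewrite 1 [← MvPolynomial.sum_homogeneousComponent p]
    simp only [map_sum, Finset.mul_sum]
    rw [Finset.sum_comm]
    exact Finset.sum_congr rfl fun e _ => h e
  rw [h2, map_sum]
  simp only [MvPolynomial.homogeneousComponent_C_mul]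
  rw [Finset.sum_eq_single d]
  · rw [MvPolynomial.homogeneousComponent_eq_self
      (MvPolynomial.homogeneousComponent_isHomogeneous d p), map_natCast]
  · intro e _ he
    rw [MvPolynomial.homogeneousComponent_of_mem
      (MvPolynomial.homogeneousComponent_isHomogeneous e p), if_neg he.symm, mul_zero]
  · intro hd
    rw [MvPolynomial.homogeneousComponent_eq_zero d p (by simpa using hd)]
    simp

/-- The degree-`d` part of `hermiteMv_ode`: the Laplacian lowers degree by two, while the Euler
operator acts on degree `d` as multiplication by `d`. -/
lemma laplacian_homogeneousComponent_hermiteMv (α : Fin n → ℕ) (d : ℕ) :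
    ∑ i, MvPolynomial.pderiv i (MvPolynomial.pderiv i
      (MvPolynomial.homogeneousComponent (d + 2) (hermiteMv α))) =
    MvPolynomial.C (2 * ((d : ℂ) - (∑ i, α i : ℕ))) *
      MvPolynomial.homogeneousComponent d (hermiteMv α) := by
  have h := congrArg (MvPolynomial.homogeneousComponent d) (hermiteMv_ode α)
  have e1 : (2 : MvPolynomial (Fin n) ℂ) = MvPolynomial.C 2 := (map_ofNat _ 2).symm
  have e2 : ((∑ i, α i : ℕ) : MvPolynomial (Fin n) ℂ) = MvPolynomial.C ((∑ i, α i : ℕ) : ℂ) := by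
    simp
  have e3 : (d : MvPolynomial (Fin n) ℂ) = MvPolynomial.C (d : ℂ) := by simp
  rw [map_add, map_sub, map_zero, e1, e2, ← MvPolynomial.C_mul,
    MvPolynomial.homogeneousComponent_C_mul, MvPolynomial.homogeneousComponent_C_mul,
    homogeneousComponent_euler, map_sum] at h
  simp only [homogeneousComponent_pderiv, e3] at h
  rw [MvPolynomial.C_mul] at h ⊢
  rw [MvPolynomial.C_sub]
  linear_combination h

/-! ### Laguerre coefficients and the two-step recursion -/

/-- The coefficients of the Laguerre polynomials. -/
def laguerreLCoeff (β : ℝ) (k i : ℕ) : ℝ :=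
  (-1) ^ i * (Real.Gamma (k + β + 1)
      / (Real.Gamma (i + β + 1) * ((k - i).factorial : ℝ) * (i.factorial : ℝ)))

lemma laguerreLCoeff_succ {β : ℝ} (hβ : -1 < β) {k i : ℕ} (hi : i < k) :
    laguerreLCoeff β k (i + 1) * ((i + 1) * (i + β + 1)) = (i - k) * laguerreLCoeff β k i := by
  obtain ⟨j, rfl⟩ := Nat.exists_eq_add_of_lt hi
  have hz : (0 : ℝ) < i + β + 1 := by
    have := Nat.cast_nonneg (α := ℝ) i
    linarith
  have h1 : ((i + 1 : ℕ) : ℝ) + β + 1 = (i + β + 1) + 1 := by push_cast; ring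
  have h2 : i + j + 1 - (i + 1) = j := by omega
  have h3 : i + j + 1 - i = j + 1 := by omega
  have hG := (Real.Gamma_pos_of_pos hz).ne'
  simp only [laguerreLCoeff]
  rw [h1, Real.Gamma_add_one hz.ne', h2, h3, Nat.factorial_succ, Nat.factorial_succ]
  push_cast
  field_simp
  ring

lemma laguerreLCoeff_zero_ne {β : ℝ} (hβ : -1 < β) (k : ℕ) : laguerreLCoeff β k 0 ≠ 0 := by
  have h1 : (0 : ℝ) < k + β + 1 := by
    have := Nat.cast_nonneg (α := ℝ) k
    linarith
  have h2 : (0 : ℝ) < (0 : ℕ) + β + 1 := by push_cast; linarith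
  have := Real.Gamma_pos_of_pos h1
  have := Real.Gamma_pos_of_pos h2
  simp only [laguerreLCoeff]
  positivity

section Recursion

variable {M n : ℕ} {m : ℂ} {s : ℕ → ℂ}

lemma recursion_eq_zero_of_lt
    (h1 : ∀ d : ℕ, ((d : ℂ) + 2 - M) * (M + d + n) * s (d + 2) = 2 * (d - m) * s d)
    (h2 : ∀ d, d < 2 → d ≠ M → s d = 0) (d : ℕ) (hd : d < M) : s d = 0 := by
  induction d using Nat.strong_induction_on with
  | _ d ih =>
    rcases lt_or_ge d 2 with h | h
    · exact h2 d h hd.ne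
    · obtain ⟨e, rfl⟩ := Nat.exists_eq_add_of_le' h
      have h3 := h1 e
      rw [ih e (by omega) (by omega), mul_zero] at h3
      have h4 : (e : ℂ) + 2 - M ≠ 0 := by
        rw [sub_ne_zero]
        exact_mod_cast hd.ne
      have h5 : (M : ℂ) + e + n ≠ 0 := by
        norm_cast
        omega
      simpa [h4, h5] using h3

/-- The value at `M + 1` comes from the one at `M - 1`, which vanishes as `M - 1 < M`; for `M = 0`
it is an initial value. -/
lemma recursion_odd_eq_zero
    (h1 : ∀ d : ℕ, ((d : ℂ) + 2 - M) * (M + d + n) * s (d + 2) = 2 * (d - m) * s d)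
    (h2 : ∀ d, d < 2 → d ≠ M → s d = 0) (j : ℕ) : s (M + 2 * j + 1) = 0 := by
  induction j with
  | zero =>
    rcases Nat.eq_zero_or_pos M with rfl | hM
    · exact h2 1 (by norm_num) (by norm_num)
    · obtain ⟨e, rfl⟩ := Nat.exists_eq_add_of_le' hM
      have h3 := h1 e
      rw [recursion_eq_zero_of_lt h1 h2 e (by omega), mul_zero] at h3
      have h4 : (e : ℂ) + 2 - (e + 1 : ℕ) ≠ 0 := by push_cast; ring_nf; norm_num
      have h5 : ((e + 1 : ℕ) : ℂ) + e + n ≠ 0 := by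
        norm_cast
        omega
      have h6 : s (e + 2) = 0 := by
        simpa only [mul_eq_zero, h4, h5, false_or] using h3
      exact h6
  | succ j ih =>
    have h3 := h1 (M + 2 * j + 1)
    rw [ih, mul_zero] at h3
    have h4 : ((M + 2 * j + 1 : ℕ) : ℂ) + 2 - M ≠ 0 := by
      rw [sub_ne_zero]
      norm_cast
      omega
    have h5 : (M : ℂ) + (M + 2 * j + 1 : ℕ) + n ≠ 0 := by
      norm_cast
      omega
    have h6 : s (M + 2 * j + 1 + 2) = 0 := by
      simpa only [mul_eq_zero, h4, h5, false_or] using h3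
    rw [← h6]
    congr 1

lemma recursion_even
    (h1 : ∀ d : ℕ, ((d : ℂ) + 2 - M) * (M + d + n) * s (d + 2) = 2 * (d - m) * s d) (j : ℕ) :
    ((2 : ℂ) * j + 2) * (2 * M + 2 * j + n) * s (M + 2 * (j + 1)) =
      2 * (M + 2 * j - m) * s (M + 2 * j) := by
  have h := h1 (M + 2 * j)
  rw [show M + 2 * (j + 1) = M + 2 * j + 2 by ring]
  push_cast at h
  linear_combination h

lemma sum_range_eq_sum_even
    (h1 : ∀ d : ℕ, ((d : ℂ) + 2 - M) * (M + d + n) * s (d + 2) = 2 * (d - m) * s d)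
    (h2 : ∀ d, d < 2 → d ≠ M → s d = 0) (N : ℕ) (r : ℂ) :
    ∑ d ∈ Finset.range (M + 2 * N), s d * r ^ d =
      ∑ j ∈ Finset.range N, s (M + 2 * j) * r ^ (M + 2 * j) := by
  induction N with
  | zero =>
    simp only [Finset.range_zero, Finset.sum_empty]
    refine Finset.sum_eq_zero fun d hd => ?_
    rw [recursion_eq_zero_of_lt h1 h2 d (by simpa using hd), zero_mul]
  | succ N ih =>
    rw [show M + 2 * (N + 1) = M + 2 * N + 1 + 1 by ring, Finset.sum_range_succ,
      Finset.sum_range_succ, ih, recursion_odd_eq_zero h1 h2, zero_mul, add_zero,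
      Finset.sum_range_succ]

/-- Run the recursion downwards from the range where `s` vanishes; the factor `M + 2j - m` is never
zero. -/
lemma recursion_eq_zero
    (h1 : ∀ d : ℕ, ((d : ℂ) + 2 - M) * (M + d + n) * s (d + 2) = 2 * (d - m) * s d)
    (hm : ∀ K : ℕ, m ≠ M + 2 * K) {N : ℕ} (h3 : ∀ d, N ≤ d → s d = 0) (j : ℕ) :
    s (M + 2 * j) = 0 := by
  have key : ∀ i j, N ≤ i + j → s (M + 2 * j) = 0 := by
    intro i
    induction i with
    | zero => exact fun j hj => h3 _ (by omega)
    | succ i ih =>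
      intro j hj
      have h := recursion_even h1 j
      rw [ih (j + 1) (by omega), mul_zero] at h
      have h4 : (M : ℂ) + 2 * j - m ≠ 0 := sub_ne_zero.2 (hm j).symm
      simpa [h4] using h.symm
  exact key N j (by omega)

/-- Since `2M + 2j + n = 2(j + β + 1)`, this is the recursion `laguerreLCoeff_succ`. At `j = K` the
factor `M + 2j - m` vanishes, and the sequence stays zero from there on. -/
lemma recursion_eq_laguerre (hn : n ≠ 0) {K : ℕ}
    (h1 : ∀ d : ℕ, ((d : ℂ) + 2 - M) * (M + d + n) * s (d + 2) = 2 * (d - m) * s d)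
    (hm : m = M + 2 * K) {β : ℝ} (hβ : β = n / 2 - 1 + M) :
    ∀ j, s (M + 2 * j) = if j ≤ K then s M / laguerreLCoeff β K 0 * laguerreLCoeff β K j else 0 := by
  have hn' : (0 : ℝ) < n := Nat.cast_pos.2 (Nat.pos_of_ne_zero hn)
  have hM' : (0 : ℝ) ≤ M := Nat.cast_nonneg _
  have hβ1 : -1 < β := by rw [hβ]; linarith
  have h0 : (laguerreLCoeff β K 0 : ℂ) ≠ 0 :=
    Complex.ofReal_ne_zero.2 (laguerreLCoeff_zero_ne hβ1 K)
  intro j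
  induction j with
  | zero => simp [h0]
  | succ j ih =>
    have h := recursion_even h1 j
    have h4 : ((2 : ℂ) * j + 2) ≠ 0 := by norm_cast
    have h5 : (2 * (M : ℂ) + 2 * j + n) ≠ 0 := by norm_cast; omega
    refine mul_left_cancel₀ (mul_ne_zero h4 h5) (h.trans ?_)
    rw [ih, hm]
    rcases lt_trichotomy j K with hj | rfl | hj
    · rw [if_pos hj.le, if_pos (Nat.succ_le_of_lt hj)]
      have h6 := congrArg (fun x : ℝ => (x : ℂ)) (laguerreLCoeff_succ hβ1 hj)
      simp only [hβ] at h6 ⊢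
      push_cast at h6 ⊢
      linear_combination (-4 * (s M / laguerreLCoeff (n / 2 - 1 + M) K 0)) * h6
    · simp
    · rw [if_neg (by omega), if_neg (by omega)]
      simp

end Recursion

/-! ### Spherical means of Hermite polynomials -/

lemma sphereIntegral_mul_hermiteMv_recursion [NeZero n] {Y : MvPolynomial (Fin n) ℂ} {M : ℕ}
    (hY : IsSolidHarmonic M Y) (α : Fin n → ℕ) (d : ℕ) :
    ((d : ℂ) + 2 - M) * (M + d + n) *
      sphereIntegral (Y * MvPolynomial.homogeneousComponent (d + 2) (hermiteMv α)) =
    2 * ((d : ℂ) - (∑ i, α i : ℕ)) *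
      sphereIntegral (Y * MvPolynomial.homogeneousComponent d (hermiteMv α)) := by
  rw [← sphereIntegral_mul_laplacian hY (MvPolynomial.homogeneousComponent_isHomogeneous _ _),
    laplacian_homogeneousComponent_hermiteMv, mul_left_comm, sphereIntegral_C_mul]

lemma integral_sphere_mul_dilation (Y p : MvPolynomial (Fin n) ℂ) (r : ℝ) {N : ℕ}
    (hN : p.totalDegree < N) :
    ∫ ω : Metric.sphere (0 : EuclideanSpace ℝ (Fin n)) 1, evalAt Y ω * evalAt p (r • (ω : _))
      ∂(volume : Measure (EuclideanSpace ℝ (Fin n))).toSphere =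
    ∑ d ∈ Finset.range N,
      sphereIntegral (Y * MvPolynomial.homogeneousComponent d p) * (r : ℂ) ^ d := by
  have hp : p = ∑ d ∈ Finset.range N, MvPolynomial.homogeneousComponent d p := by
    nth_rewrite 1 [← MvPolynomial.sum_homogeneousComponent p]
    refine Finset.sum_subset (fun d hd => ?_) fun d _ hd => ?_
    · rw [Finset.mem_range] at hd ⊢; omega
    · exact MvPolynomial.homogeneousComponent_eq_zero d p (by simpa using hd)
  have h : ∀ ω : EuclideanSpace ℝ (Fin n), evalAt Y ω * evalAt p (r • ω) =
      ∑ d ∈ Finset.range N,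
        evalAt (Y * MvPolynomial.homogeneousComponent d p) ω * (r : ℂ) ^ d := by
    intro ω
    nth_rewrite 1 [hp]
    rw [evalAt_sum, Finset.mul_sum]
    refine Finset.sum_congr rfl fun d _ => ?_
    rw [evalAt_smul (MvPolynomial.homogeneousComponent_isHomogeneous d p), evalAt_mul]
    ring
  simp only [h]
  rw [integral_finsetSum _ fun d _ => (integrable_sphere (continuous_evalAt _)).mul_const _]
  simp only [integral_mul_const, sphereIntegral]

/-- The spherical means of a Hermite polynomial against a solid harmonic are Laguerre
polynomials. -/
lemma exists_integral_sphere_mul_hermiteMv [NeZero n] {Y : MvPolynomial (Fin n) ℂ} {M : ℕ}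
    (hY : IsSolidHarmonic M Y) (α : Fin n → ℕ) {K : ℕ} (hα : ∑ i, α i = M + 2 * K) :
    ∃ c : ℂ, ∀ r : ℝ,
      ∫ ω : Metric.sphere (0 : EuclideanSpace ℝ (Fin n)) 1,
        evalAt Y ω * evalAt (hermiteMv α) (r • (ω : _))
        ∂(volume : Measure (EuclideanSpace ℝ (Fin n))).toSphere =
      c * (r : ℂ) ^ M * (laguerreL ((n : ℝ) / 2 - 1 + M) K (r ^ 2) : ℂ) := by
  set s : ℕ → ℂ := fun d => sphereIntegral (Y * MvPolynomial.homogeneousComponent d (hermiteMv α))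
  have h1 := sphereIntegral_mul_hermiteMv_recursion hY α
  have h2 : ∀ d, d < 2 → d ≠ M → s d = 0 := fun d hd hdM =>
    sphereIntegral_mul_eq_zero hY (MvPolynomial.homogeneousComponent_isHomogeneous _ _) hd hdM
  have h3 := recursion_eq_laguerre (s := s) (NeZero.ne n) h1 (K := K) (by rw [hα]; push_cast; rfl) rfl
  refine ⟨s M / laguerreLCoeff ((n : ℝ) / 2 - 1 + M) K 0, fun r => ?_⟩
  -- Any cutoff `M + 2N` above the degree with `N ≥ K + 1` would do; the extra terms vanish.
  have hN : (hermiteMv α).totalDegree < M + 2 * (K + 1 + (hermiteMv α).totalDegree) := by omega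
  rw [integral_sphere_mul_dilation Y _ r hN,
    sum_range_eq_sum_even (s := s) h1 h2 _ (r : ℂ)]
  simp only [h3]
  rw [← Finset.sum_subset (Finset.range_mono (Nat.le_add_right (K + 1) _)) (fun j _ hj => by
      rw [if_neg (by simpa using hj), zero_mul]), laguerreL]
  push_cast
  rw [Finset.mul_sum]
  refine Finset.sum_congr rfl fun j hj => ?_
  rw [if_pos (Nat.lt_succ_iff.1 (Finset.mem_range.1 hj))]
  rw [laguerreLCoeff, laguerreLCoeff]
  push_cast
  ring

lemma integral_sphere_mul_hermiteMv_eq_zero [NeZero n] {Y : MvPolynomial (Fin n) ℂ} {M : ℕ}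
    (hY : IsSolidHarmonic M Y) (α : Fin n → ℕ) (hα : ∀ K : ℕ, ∑ i, α i ≠ M + 2 * K) (r : ℝ) :
    ∫ ω : Metric.sphere (0 : EuclideanSpace ℝ (Fin n)) 1,
      evalAt Y ω * evalAt (hermiteMv α) (r • (ω : _))
      ∂(volume : Measure (EuclideanSpace ℝ (Fin n))).toSphere = 0 := by
  set s : ℕ → ℂ := fun d => sphereIntegral (Y * MvPolynomial.homogeneousComponent d (hermiteMv α))
  have h1 := sphereIntegral_mul_hermiteMv_recursion hY α
  have h2 : ∀ d, d < 2 → d ≠ M → s d = 0 := fun d hd hdM =>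
    sphereIntegral_mul_eq_zero hY (MvPolynomial.homogeneousComponent_isHomogeneous _ _) hd hdM
  have h3 := recursion_eq_zero (s := s) h1
    (fun K => by exact_mod_cast hα K) (N := (hermiteMv α).totalDegree + 1) (fun d hd => by
      simp only [s]
      rw [MvPolynomial.homogeneousComponent_eq_zero d _ (by omega), mul_zero]
      simp [sphereIntegral, evalAt])
  have hN : (hermiteMv α).totalDegree < M + 2 * (1 + (hermiteMv α).totalDegree) := by omega
  rw [integral_sphere_mul_dilation Y _ r hN,
    sum_range_eq_sum_even (s := s) h1 h2 _ (r : ℂ)]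
  exact Finset.sum_eq_zero fun j _ => by rw [h3, zero_mul]

/-! ### Orthonormality of the Laguerre functions -/

lemma Gamma_add_natCast {x : ℝ} (hx : 0 < x) (j : ℕ) :
    Real.Gamma (x + j) = (ascPochhammer ℝ j).eval x * Real.Gamma x := by
  induction j with
  | zero => simp
  | succ j ih =>
    have h : x + j ≠ 0 := by positivity
    rw [ascPochhammer_succ_eval, Nat.cast_succ, ← add_assoc, Real.Gamma_add_one h, ih]
    ring

-- Up to the sign `(-1)^k`, the sum is the `k`-th finite difference at `0`, which kills degree below
-- `k` and sends a monic polynomial of degree `k` to `k!`.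
open fwdDiff in
lemma alternating_sum_choose_mul_eval (P : Polynomial ℝ) (k : ℕ) (hP : P.Monic)
    (hk : P.natDegree ≤ k) :
    ∑ i ∈ Finset.range (k + 1), (-1 : ℝ) ^ i * (k.choose i : ℝ) * P.eval (i : ℝ) =
      if P.natDegree = k then (-1 : ℝ) ^ k * k.factorial else 0 := by
  have h := fwdDiff_iter_eq_sum_shift (1 : ℝ) P.eval k 0
  have h2 : ∑ i ∈ Finset.range (k + 1), (-1 : ℝ) ^ i * (k.choose i : ℝ) * P.eval (i : ℝ) =
      (-1) ^ k * (fwdDiff (1 : ℝ))^[k] P.eval 0 := by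
    rw [h, Finset.mul_sum]
    refine Finset.sum_congr rfl fun i hi => ?_
    have hi' : i ≤ k := Nat.lt_succ_iff.1 (Finset.mem_range.1 hi)
    obtain ⟨j, rfl⟩ := Nat.exists_eq_add_of_le hi'
    have hj : ((-1 : ℝ) ^ j) * (-1) ^ j = 1 := by rw [← mul_pow]; simp
    simp only [Nat.add_sub_cancel_left, zsmul_eq_mul, nsmul_eq_mul, mul_one, zero_add]
    push_cast
    rw [pow_add]
    linear_combination (-((-1 : ℝ) ^ i * ((i + j).choose i : ℝ) * P.eval (i : ℝ))) * hj
  rw [h2]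
  split_ifs with hd
  · have := congrFun (Polynomial.fwdDiff_iter_degree_eq_factorial P) 0
    rw [hd] at this
    rw [this, hP.leadingCoeff]
    simp
  · rw [Polynomial.fwdDiff_iter_eq_zero_of_degree_lt (lt_of_le_of_ne hk hd)]
    simp

/-- The ratio `Γ(i+β+1+j) / Γ(i+β+1)` is a monic polynomial of degree `j` in `i`, so this is a
`k`-th finite difference. It amounts to pairing `L_k^β` with `t^j`. -/
lemma sum_laguerreLCoeff_mul_Gamma {β : ℝ} (hβ : -1 < β) {j k : ℕ} (hjk : j ≤ k) :
    ∑ i ∈ Finset.range (k + 1), laguerreLCoeff β k i * Real.Gamma (i + β + 1 + j) =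
      if j = k then (-1) ^ k * Real.Gamma (k + β + 1) else 0 := by
  set P : Polynomial ℝ := (ascPochhammer ℝ j).comp (Polynomial.X + Polynomial.C (β + 1))
  have hP : P.Monic := (monic_ascPochhammer ℝ j).comp_X_add_C _
  have hd : P.natDegree = j := by
    simp only [P, Polynomial.natDegree_comp, ascPochhammer_natDegree, mul_one,
      Polynomial.natDegree_X_add_C]
  have h := alternating_sum_choose_mul_eval P k hP (by rw [hd]; exact hjk)
  have hk : (k.factorial : ℝ) ≠ 0 := by positivity
  have h2 : ∑ i ∈ Finset.range (k + 1), laguerreLCoeff β k i * Real.Gamma (i + β + 1 + j) =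
      Real.Gamma (k + β + 1) / k.factorial *
        ∑ i ∈ Finset.range (k + 1), (-1 : ℝ) ^ i * (k.choose i : ℝ) * P.eval (i : ℝ) := by
    rw [Finset.mul_sum]
    refine Finset.sum_congr rfl fun i hi => ?_
    have hi' : i ≤ k := Nat.lt_succ_iff.1 (Finset.mem_range.1 hi)
    have hz : (0 : ℝ) < i + β + 1 := by
      have := Nat.cast_nonneg (α := ℝ) i
      linarith
    have hG := (Real.Gamma_pos_of_pos hz).ne'
    have hPe : P.eval (i : ℝ) = (ascPochhammer ℝ j).eval (i + β + 1) := by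
      simp [P, Polynomial.eval_comp, add_assoc]
    rw [Gamma_add_natCast hz, hPe, laguerreLCoeff, Nat.cast_choose ℝ hi']
    field_simp
  rw [h2, h, hd]
  split_ifs
  · field_simp
  · simp

lemma integrableOn_laguerre_moment {β : ℝ} (hβ : -1 < β) (j : ℕ) :
    IntegrableOn (fun r : ℝ => r ^ (2 * β + 1) * (r ^ 2) ^ j * Real.exp (-r ^ 2)) (Set.Ioi 0) := by
  have hj := Nat.cast_nonneg (α := ℝ) j
  have h := integrableOn_rpow_mul_exp_neg_mul_sq (b := 1) one_pos
    (s := 2 * β + 1 + ((2 * j : ℕ) : ℝ)) (by push_cast; linarith)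
  refine h.congr_fun (fun r hr => ?_) measurableSet_Ioi
  simp only
  rw [Real.rpow_add hr, Real.rpow_natCast, pow_mul, neg_one_mul]

lemma integral_laguerre_moment {β : ℝ} (hβ : -1 < β) (j : ℕ) :
    ∫ r in Set.Ioi (0 : ℝ), r ^ (2 * β + 1) * (r ^ 2) ^ j * Real.exp (-r ^ 2) =
      Real.Gamma (β + 1 + j) / 2 := by
  have hj := Nat.cast_nonneg (α := ℝ) j
  have h := integral_rpow_mul_exp_neg_rpow (p := 2) two_pos
    (q := 2 * β + 1 + ((2 * j : ℕ) : ℝ)) (by push_cast; linarith)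
  have h2 : (2 * β + 1 + ((2 * j : ℕ) : ℝ) + 1) / 2 = β + 1 + j := by push_cast; ring
  rw [h2] at h
  rw [div_eq_inv_mul, ← one_div, ← h]
  refine setIntegral_congr_fun measurableSet_Ioi (fun r hr => ?_)
  rw [eq_comm, Real.rpow_add hr, Real.rpow_natCast, pow_mul, Real.rpow_two]

lemma laguerreL_eq (β : ℝ) (k : ℕ) (t : ℝ) :
    laguerreL β k t = ∑ i ∈ Finset.range (k + 1), laguerreLCoeff β k i * t ^ i := rfl

lemma laguerreL_mul_expand (β : ℝ) (k l : ℕ) (r : ℝ) :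
    r ^ (2 * β + 1) * (laguerreL β k (r ^ 2) * laguerreL β l (r ^ 2) * Real.exp (-r ^ 2)) =
      ∑ j ∈ Finset.range (l + 1), ∑ i ∈ Finset.range (k + 1),
        laguerreLCoeff β l j * (laguerreLCoeff β k i *
          (r ^ (2 * β + 1) * (r ^ 2) ^ (i + j) * Real.exp (-r ^ 2))) := by
  rw [laguerreL_eq, laguerreL_eq, Finset.sum_mul_sum, Finset.sum_comm, Finset.sum_mul,
    Finset.mul_sum]
  refine Finset.sum_congr rfl fun j _ => ?_
  rw [Finset.sum_mul, Finset.mul_sum]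
  refine Finset.sum_congr rfl fun i _ => ?_
  rw [pow_add]
  ring

lemma integral_laguerreL_mul_of_le {β : ℝ} (hβ : -1 < β) {k l : ℕ} (hlk : l ≤ k) :
    ∫ r in Set.Ioi (0 : ℝ),
      r ^ (2 * β + 1) * (laguerreL β k (r ^ 2) * laguerreL β l (r ^ 2) * Real.exp (-r ^ 2)) =
      if l = k then Real.Gamma (k + β + 1) / (2 * k.factorial) else 0 := by
  have hint := fun (i j : ℕ) => integrableOn_laguerre_moment hβ (i + j)
  simp only [laguerreL_mul_expand]
  rw [integral_finsetSum _ fun j _ => integrable_finsetSum _ fun i _ =>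
    ((hint i j).const_mul _).const_mul _]
  have h : ∀ j ∈ Finset.range (l + 1),
      ∫ r in Set.Ioi (0 : ℝ), ∑ i ∈ Finset.range (k + 1),
        laguerreLCoeff β l j * (laguerreLCoeff β k i *
          (r ^ (2 * β + 1) * (r ^ 2) ^ (i + j) * Real.exp (-r ^ 2))) =
      laguerreLCoeff β l j / 2 * if j = k then (-1) ^ k * Real.Gamma (k + β + 1) else 0 := by
    intro j hj
    have hjl : j ≤ l := Nat.lt_succ_iff.1 (Finset.mem_range.1 hj)
    rw [integral_finsetSum _ fun i _ => ((hint i j).const_mul _).const_mul _]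
    simp only [integral_const_mul, integral_laguerre_moment hβ]
    rw [← sum_laguerreLCoeff_mul_Gamma hβ (hjl.trans hlk), Finset.mul_sum]
    refine Finset.sum_congr rfl fun i _ => ?_
    rw [show β + 1 + ((i + j : ℕ) : ℝ) = i + β + 1 + j by push_cast; ring]
    ring
  rw [Finset.sum_congr rfl h]
  split_ifs with hl
  · subst hl
    rw [Finset.sum_range_succ, Finset.sum_eq_zero fun j hj => ?_]
    · have hz : (0 : ℝ) < l + β + 1 := by
        have := Nat.cast_nonneg (α := ℝ) l
        linarith
      have hG := (Real.Gamma_pos_of_pos hz).ne'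
      have h1 : ((-1 : ℝ) ^ l) * (-1) ^ l = 1 := by rw [← mul_pow]; simp
      simp only [laguerreLCoeff, Nat.sub_self, Nat.factorial_zero, Nat.cast_one, mul_one,
        if_true, zero_add]
      field_simp
      rw [pow_two, h1]
    · rw [if_neg (Finset.mem_range.1 hj).ne, mul_zero]
  · refine Finset.sum_eq_zero fun j hj => ?_
    rw [if_neg, mul_zero]
    have := Finset.mem_range.1 hj
    omega

lemma integral_laguerreL_mul {β : ℝ} (hβ : -1 < β) (k l : ℕ) :
    ∫ r in Set.Ioi (0 : ℝ),
      r ^ (2 * β + 1) * (laguerreL β k (r ^ 2) * laguerreL β l (r ^ 2) * Real.exp (-r ^ 2)) =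
      if l = k then Real.Gamma (k + β + 1) / (2 * k.factorial) else 0 := by
  rcases le_total l k with h | h
  · exact integral_laguerreL_mul_of_le hβ h
  · have h2 := integral_laguerreL_mul_of_le hβ h
    simp only [mul_comm (laguerreL β l _)] at h2
    rw [h2]
    by_cases hkl : k = l
    · simp [hkl]
    · rw [if_neg hkl, if_neg (Ne.symm hkl)]

lemma integral_laguerreMeasure (β : ℝ) (F : ℝ → ℂ) :
    ∫ r, F r ∂(laguerreMeasure β) =
      ∫ r in Set.Ioi (0 : ℝ), ((r ^ (2 * β + 1) : ℝ) : ℂ) * F r := by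
  simp only [laguerreMeasure, ENNReal.ofReal]
  rw [integral_withDensity_eq_integral_smul (by fun_prop)]
  refine setIntegral_congr_fun measurableSet_Ioi fun r hr => ?_
  rw [NNReal.smul_def, Real.coe_toNNReal _ (Real.rpow_nonneg (le_of_lt hr) _), Complex.real_smul]

lemma laguerreCoeff_laguerreFunction {β : ℝ} (hβ : -1 < β) (k l : ℕ) :
    laguerreCoeff β l (fun r => (laguerreFunction β k r : ℂ)) = if l = k then 1 else 0 := by
  rw [laguerreCoeff, integral_laguerreMeasure]
  set c : ℕ → ℝ := fun k => Real.sqrt (2 * Real.Gamma (k + 1) / Real.Gamma (k + β + 1))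
  have h : ∀ r : ℝ, ((r ^ (2 * β + 1) : ℝ) : ℂ) *
      ((laguerreFunction β k r : ℂ) * (laguerreFunction β l r : ℂ)) =
      ((c k * c l * (r ^ (2 * β + 1) *
        (laguerreL β k (r ^ 2) * laguerreL β l (r ^ 2) * Real.exp (-r ^ 2))) : ℝ) : ℂ) := by
    intro r
    have he : Real.exp (-r ^ 2) = Real.exp (-r ^ 2 / 2) * Real.exp (-r ^ 2 / 2) := by
      rw [← Real.exp_add]; ring_nf
    rw [← Complex.ofReal_mul, ← Complex.ofReal_mul, he, laguerreFunction, laguerreFunction]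
    congr 1
    ring
  simp only [h]
  rw [integral_complex_ofReal, integral_const_mul, integral_laguerreL_mul hβ]
  split_ifs with hkl
  · subst hkl
    have hz : (0 : ℝ) < l + β + 1 := by
      have := Nat.cast_nonneg (α := ℝ) l
      linarith
    have hG := Real.Gamma_pos_of_pos hz
    rw [← sq, Real.sq_sqrt (by rw [Real.Gamma_nat_eq_factorial]; positivity),
      Real.Gamma_nat_eq_factorial]
    have : 2 * (l.factorial : ℝ) / Real.Gamma (l + β + 1) *
        (Real.Gamma (l + β + 1) / (2 * l.factorial)) = 1 := by field_simp
    rw [this, Complex.ofReal_one]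
  · simp

/-! ### Hermite coefficients of a radial function times a solid harmonic -/

lemma exp_half_mul_self (t : ℝ) :
    (Real.exp (-t ^ 2 / 2) : ℂ) * Real.exp (-t ^ 2 / 2) = Real.exp (-t ^ 2) := by
  rw [← Complex.ofReal_mul, ← Real.exp_add]
  ring_nf

lemma continuous_hermiteFunction (α : Fin n → ℕ) :
    Continuous fun x => (hermiteFunction α x : ℂ) := by
  simp only [hermiteFunction_eq]
  fun_prop

lemma memLp_hermiteFunction (α : Fin n → ℕ) :
    MemLp (fun x => (hermiteFunction α x : ℂ)) 2 volume := by
  rw [memLp_two_iff_integrable_sq_norm (continuous_hermiteFunction α).aestronglyMeasurable]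
  have h := ((integrable_evalAt_mul_exp (hermiteMv α * hermiteMv α)).const_mul
    ((((Real.sqrt (hermiteNormSq α))⁻¹ : ℝ) : ℂ) ^ 2)).norm
  refine h.congr (.of_forall fun x => ?_)
  simp only
  rw [← norm_pow]
  congr 1
  rw [hermiteFunction_eq, evalAt_mul, ← exp_half_mul_self]
  ring

/-- The Jacobian gives `r^{n-1}`; one factor `r^M` comes from `Y`, the other from the spherical mean
of the Hermite polynomial. -/
lemma rpow_exponent [NeZero n] (M : ℕ) (r : ℝ) :
    r ^ (2 * ((n : ℝ) / 2 - 1 + M) + 1) = r ^ (n - 1) * (r ^ M) ^ 2 := by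
  have hn : 1 ≤ n := Nat.one_le_iff_ne_zero.2 (NeZero.ne n)
  have h : 2 * ((n : ℝ) / 2 - 1 + M) + 1 = ((n - 1 + M * 2 : ℕ) : ℝ) := by
    push_cast [Nat.cast_sub hn]
    ring
  rw [h, Real.rpow_natCast, pow_add, pow_mul]

/-- The pairing with a Hermite function of a product of a radial function and a polynomial, in
polar coordinates. -/
lemma integral_radial_mul_hermiteFunction (Y : MvPolynomial (Fin n) ℂ) {M : ℕ} [NeZero n]
    (hY : Y.IsHomogeneous M) (α : Fin n → ℕ) (f₀ : ℝ → ℂ)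
    (hf : Integrable fun x : EuclideanSpace ℝ (Fin n) =>
      f₀ ‖x‖ * evalAt Y x * (hermiteFunction α x : ℂ)) :
    ∫ x : EuclideanSpace ℝ (Fin n), f₀ ‖x‖ * evalAt Y x * (hermiteFunction α x : ℂ) =
      ∫ r in Set.Ioi (0 : ℝ), ((r ^ (n - 1) : ℝ) : ℂ) *
        (f₀ r * (r : ℂ) ^ M * ((Real.sqrt (hermiteNormSq α))⁻¹ : ℝ) *
          (Real.exp (-r ^ 2 / 2) : ℂ) *
          ∫ ω : Metric.sphere (0 : EuclideanSpace ℝ (Fin n)) 1,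
            evalAt Y ω * evalAt (hermiteMv α) (r • (ω : _))
            ∂(volume : Measure (EuclideanSpace ℝ (Fin n))).toSphere) := by
  rw [← integral_polar volume hf.aestronglyMeasurable,
    integral_prod_symm _ (integrable_polar volume hf), finrank_euclideanSpace_fin,
    ← integral_volumeIoiPow (n - 1) (fun r => f₀ r * (r : ℂ) ^ M *
      ((Real.sqrt (hermiteNormSq α))⁻¹ : ℝ) * (Real.exp (-r ^ 2 / 2) : ℂ) *
        ∫ ω : Metric.sphere (0 : EuclideanSpace ℝ (Fin n)) 1,
          evalAt Y ω * evalAt (hermiteMv α) (r • (ω : _))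
          ∂(volume : Measure (EuclideanSpace ℝ (Fin n))).toSphere)]
  refine integral_congr_ae (.of_forall fun r => ?_)
  have hr : (0 : ℝ) < r := r.2
  simp only
  rw [← integral_const_mul]
  refine integral_congr_ae (.of_forall fun ω => ?_)
  simp only
  rw [evalAt_smul hY, hermiteFunction_eq, norm_smul, norm_eq_of_mem_sphere, mul_one,
    Real.norm_of_nonneg hr.le]
  ring

lemma neg_one_lt_order [NeZero n] (M : ℕ) : -1 < (n : ℝ) / 2 - 1 + M := by
  have hn : (0 : ℝ) < n := Nat.cast_pos.2 (Nat.pos_of_ne_zero (NeZero.ne n))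
  have hM : (0 : ℝ) ≤ M := Nat.cast_nonneg _
  linarith

/-- The order of quantifiers matters: `C` does not depend on `f₀`, so it can be found later by
testing with `f₀ = ℓ_K^β`. -/
lemma exists_integral_radial_mul_hermiteFunction [NeZero n] {Y : MvPolynomial (Fin n) ℂ} {M : ℕ}
    (hY : IsSolidHarmonic M Y) (α : Fin n → ℕ) {K : ℕ} (hα : ∑ i, α i = M + 2 * K) :
    ∃ C : ℂ, ∀ f₀ : ℝ → ℂ, Integrable (fun x : EuclideanSpace ℝ (Fin n) =>
        f₀ ‖x‖ * evalAt Y x * (hermiteFunction α x : ℂ)) →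
      ∫ x : EuclideanSpace ℝ (Fin n), f₀ ‖x‖ * evalAt Y x * (hermiteFunction α x : ℂ) =
        C * laguerreCoeff ((n : ℝ) / 2 - 1 + M) K f₀ := by
  obtain ⟨c, hc⟩ := exists_integral_sphere_mul_hermiteMv hY α hα
  set β : ℝ := (n : ℝ) / 2 - 1 + M
  have hβ : -1 < β := neg_one_lt_order M
  set b : ℝ := Real.sqrt (2 * Real.Gamma (K + 1) / Real.Gamma (K + β + 1))
  have hb : (b : ℂ) ≠ 0 := by
    have hz : (0 : ℝ) < K + β + 1 := by
      have := Nat.cast_nonneg (α := ℝ) K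
      linarith
    have h1 := Real.Gamma_pos_of_pos hz
    have h2 : 0 < Real.Gamma ((K : ℝ) + 1) := Real.Gamma_pos_of_pos (by positivity)
    exact Complex.ofReal_ne_zero.2 (Real.sqrt_pos.2 (by positivity)).ne'
  refine ⟨((Real.sqrt (hermiteNormSq α))⁻¹ : ℝ) * c / b, fun f₀ hf => ?_⟩
  rw [integral_radial_mul_hermiteFunction Y hY.1 α f₀ hf, laguerreCoeff, integral_laguerreMeasure,
    ← integral_const_mul]
  refine setIntegral_congr_fun measurableSet_Ioi fun r hr => ?_
  have hl : laguerreFunction β K r = b * laguerreL β K (r ^ 2) * Real.exp (-r ^ 2 / 2) := rfl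
  rw [hc, rpow_exponent M r, hl]
  clear_value b
  push_cast
  field_simp

lemma integral_radial_mul_hermiteFunction_eq_zero [NeZero n] {Y : MvPolynomial (Fin n) ℂ} {M : ℕ}
    (hY : IsSolidHarmonic M Y) (α : Fin n → ℕ) (hα : ∀ K : ℕ, ∑ i, α i ≠ M + 2 * K)
    (f₀ : ℝ → ℂ) (hf : Integrable fun x : EuclideanSpace ℝ (Fin n) =>
      f₀ ‖x‖ * evalAt Y x * (hermiteFunction α x : ℂ)) :
    ∫ x : EuclideanSpace ℝ (Fin n), f₀ ‖x‖ * evalAt Y x * (hermiteFunction α x : ℂ) = 0 := by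
  rw [integral_radial_mul_hermiteFunction Y hY.1 α f₀ hf]
  simp only [integral_sphere_mul_hermiteMv_eq_zero hY α hα, mul_zero, integral_zero]

/-! ### Hermite expansion of `ℓ_K^β(|x|) Y(x)` -/

/-- The polynomial part of `ℓ_K^β(|x|) Y(x)`. -/
def laguerreMv (β : ℝ) (K : ℕ) (Y : MvPolynomial (Fin n) ℂ) : MvPolynomial (Fin n) ℂ :=
  MvPolynomial.C ((Real.sqrt (2 * Real.Gamma (K + 1) / Real.Gamma (K + β + 1)) : ℝ) : ℂ) *
    (∑ i ∈ Finset.range (K + 1), MvPolynomial.C (laguerreLCoeff β K i : ℂ) *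
      (∑ j, MvPolynomial.X j ^ 2) ^ i) * Y

lemma evalAt_laguerreMv (β : ℝ) (K : ℕ) (Y : MvPolynomial (Fin n) ℂ)
    (x : EuclideanSpace ℝ (Fin n)) :
    evalAt (laguerreMv β K Y) x * (Real.exp (-‖x‖ ^ 2 / 2) : ℂ) =
      (laguerreFunction β K ‖x‖ : ℂ) * evalAt Y x := by
  have h : evalAt (∑ i ∈ Finset.range (K + 1), MvPolynomial.C (laguerreLCoeff β K i : ℂ) *
      (∑ j : Fin n, MvPolynomial.X j ^ 2) ^ i) x = (laguerreL β K (‖x‖ ^ 2) : ℂ) := by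
    rw [evalAt_sum, laguerreL_eq, EuclideanSpace.real_norm_sq_eq]
    push_cast
    refine Finset.sum_congr rfl fun i _ => ?_
    simp [evalAt]
  rw [laguerreMv, evalAt_mul, evalAt_mul, evalAt_C, h, laguerreFunction]
  push_cast
  ring

lemma laguerreFunction_mul_hermiteFunction (β : ℝ) (K : ℕ) (Y : MvPolynomial (Fin n) ℂ)
    (α : Fin n → ℕ) (x : EuclideanSpace ℝ (Fin n)) :
    (laguerreFunction β K ‖x‖ : ℂ) * evalAt Y x * (hermiteFunction α x : ℂ) =
      ((Real.sqrt (hermiteNormSq α))⁻¹ : ℝ) *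
        (evalAt (laguerreMv β K Y * hermiteMv α) x * (Real.exp (-‖x‖ ^ 2) : ℂ)) := by
  rw [← evalAt_laguerreMv, hermiteFunction_eq, evalAt_mul, ← exp_half_mul_self]
  ring

lemma integrable_laguerreFunction_mul_hermiteFunction (β : ℝ) (K : ℕ)
    (Y : MvPolynomial (Fin n) ℂ) (α : Fin n → ℕ) :
    Integrable fun x : EuclideanSpace ℝ (Fin n) =>
      (laguerreFunction β K ‖x‖ : ℂ) * evalAt Y x * (hermiteFunction α x : ℂ) := by
  simp only [laguerreFunction_mul_hermiteFunction]
  exact (integrable_evalAt_mul_exp _).const_mul _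

lemma integral_laguerreFunction_mul_hermiteFunction (β : ℝ) (K : ℕ)
    (Y : MvPolynomial (Fin n) ℂ) (α : Fin n → ℕ) :
    ∫ x : EuclideanSpace ℝ (Fin n),
      (laguerreFunction β K ‖x‖ : ℂ) * evalAt Y x * (hermiteFunction α x : ℂ) =
      ((Real.sqrt (hermiteNormSq α))⁻¹ : ℝ) *
        gaussIntegral (laguerreMv β K Y * hermiteMv α) := by
  simp only [laguerreFunction_mul_hermiteFunction]
  exact integral_const_mul _ _

/-- Up to a nonzero factor this is a Hermite coefficient of `ℓ_K^β(|x|) Y(x)`. For `|α| = M + 2L` it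
is a multiple of `⟨ℓ_K^β, ℓ_L^β⟩ = 0`; for other `α` the spherical mean vanishes. -/
lemma gaussIntegral_laguerreMv_mul_eq_zero [NeZero n] {Y : MvPolynomial (Fin n) ℂ} {M : ℕ}
    (hY : IsSolidHarmonic M Y) (K : ℕ) (α : Fin n → ℕ) (hα : ∑ i, α i ≠ M + 2 * K) :
    gaussIntegral (laguerreMv ((n : ℝ) / 2 - 1 + M) K Y * hermiteMv α) = 0 := by
  have hN : (((Real.sqrt (hermiteNormSq α))⁻¹ : ℝ) : ℂ) ≠ 0 :=
    Complex.ofReal_ne_zero.2 (inv_pos.2 (Real.sqrt_pos.2 (hermiteNormSq_pos α))).ne'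
  refine (mul_eq_zero.1 ?_).resolve_left hN
  rw [← integral_laguerreFunction_mul_hermiteFunction]
  have hint := integrable_laguerreFunction_mul_hermiteFunction ((n : ℝ) / 2 - 1 + M) K Y α
  by_cases h : ∃ L, ∑ i, α i = M + 2 * L
  · obtain ⟨L, hL⟩ := h
    obtain ⟨C, hC⟩ := exists_integral_radial_mul_hermiteFunction hY α hL
    rw [hC (fun r => (laguerreFunction _ K r : ℂ)) hint,
      laguerreCoeff_laguerreFunction (neg_one_lt_order M), if_neg, mul_zero]
    rintro rfl
    exact hα hL
  · exact integral_radial_mul_hermiteFunction_eq_zero hY α (fun L hL => h ⟨L, hL⟩)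
      (fun r => (laguerreFunction _ K r : ℂ)) hint

lemma integral_radial_mul_hermiteFunction_eq [NeZero n] {Y : MvPolynomial (Fin n) ℂ} {M : ℕ}
    (hY : IsSolidHarmonic M Y) (α : Fin n → ℕ) {K : ℕ} (hα : ∑ i, α i = M + 2 * K)
    (f₀ : ℝ → ℂ) (hf : Integrable fun x : EuclideanSpace ℝ (Fin n) =>
      f₀ ‖x‖ * evalAt Y x * (hermiteFunction α x : ℂ)) :
    ∫ x : EuclideanSpace ℝ (Fin n), f₀ ‖x‖ * evalAt Y x * (hermiteFunction α x : ℂ) =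
      laguerreCoeff ((n : ℝ) / 2 - 1 + M) K f₀ * (((Real.sqrt (hermiteNormSq α))⁻¹ : ℝ) *
        gaussIntegral (laguerreMv ((n : ℝ) / 2 - 1 + M) K Y * hermiteMv α)) := by
  obtain ⟨C, hC⟩ := exists_integral_radial_mul_hermiteFunction hY α hα
  have h := hC (fun r => (laguerreFunction _ K r : ℂ))
    (integrable_laguerreFunction_mul_hermiteFunction ((n : ℝ) / 2 - 1 + M) K Y α)
  rw [laguerreCoeff_laguerreFunction (neg_one_lt_order M), if_pos rfl, mul_one,
    integral_laguerreFunction_mul_hermiteFunction] at h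
  rw [hC f₀ hf, h, mul_comm]

lemma laguerreFunction_mul_eq_sum [NeZero n] {Y : MvPolynomial (Fin n) ℂ} {M : ℕ}
    (hY : IsSolidHarmonic M Y) (K : ℕ) (x : EuclideanSpace ℝ (Fin n)) :
    (laguerreFunction ((n : ℝ) / 2 - 1 + M) K ‖x‖ : ℂ) * evalAt Y x =
      ∑ α ∈ Finset.piAntidiag (Finset.univ : Finset (Fin n)) (M + 2 * K),
        (((Real.sqrt (hermiteNormSq α))⁻¹ : ℝ) *
          gaussIntegral (laguerreMv ((n : ℝ) / 2 - 1 + M) K Y * hermiteMv α)) *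
          (hermiteFunction α x : ℂ) := by
  rw [← evalAt_laguerreMv]
  nth_rewrite 1 [eq_sum_hermiteMv (laguerreMv ((n : ℝ) / 2 - 1 + M) K Y) (M + 2 * K)
    (gaussIntegral_laguerreMv_mul_eq_zero hY K)]
  rw [evalAt_sum, Finset.sum_mul]
  refine Finset.sum_congr rfl fun α _ => ?_
  have hN : (((Real.sqrt (hermiteNormSq α))⁻¹ : ℝ) : ℂ) * ((Real.sqrt (hermiteNormSq α))⁻¹ : ℝ) =
      (hermiteNormSq α : ℂ)⁻¹ := by
    rw [← Complex.ofReal_mul, ← mul_inv, Real.mul_self_sqrt (hermiteNormSq_pos α).le,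
      Complex.ofReal_inv]
  rw [evalAt_mul, evalAt_C, hermiteFunction_eq, div_eq_mul_inv, ← hN]
  ring

/-! ### Square integrability of the radial profile -/

lemma map_volumeIoiPow (k : ℕ) :
    (Measure.volumeIoiPow k).map Subtype.val =
      (volume.restrict (Set.Ioi (0 : ℝ))).withDensity fun r => ENNReal.ofReal (r ^ k) := by
  ext s hs
  rw [Measure.map_apply measurable_subtype_coe hs, Measure.volumeIoiPow,
    withDensity_apply _ (measurable_subtype_coe hs), withDensity_apply _ hs,
    ← map_comap_subtype_coe measurableSet_Ioi, setLIntegral_map hs (by fun_prop) (by fun_prop)]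

lemma laguerreMeasure_eq [NeZero n] (M : ℕ) :
    laguerreMeasure ((n : ℝ) / 2 - 1 + M) =
      ((Measure.volumeIoiPow (n - 1)).map Subtype.val).withDensity
        fun r => ENNReal.ofReal ((r ^ M) ^ 2) := by
  rw [map_volumeIoiPow, ← withDensity_mul _ (by fun_prop) (by fun_prop), laguerreMeasure]
  refine withDensity_congr_ae ?_
  filter_upwards [ae_restrict_mem measurableSet_Ioi] with r hr
  rw [rpow_exponent M r, Pi.mul_apply, ENNReal.ofReal_mul (pow_nonneg (le_of_lt hr) _)]

lemma memLp_withDensity_of_memLp_mul {μ : Measure ℝ} (M : ℕ) {f₀ : ℝ → ℂ} (h0 : ∀ᵐ r ∂μ, 0 < r)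
    (hf : MemLp (fun r : ℝ => f₀ r * (r : ℂ) ^ M) 2 μ) :
    MemLp f₀ 2 (μ.withDensity fun r => ENNReal.ofReal ((r ^ M) ^ 2)) := by
  -- Measurability of `f₀` is not assumed; it is recovered by dividing by `r^M`, nonzero for `r >
  -- 0`.
  have hm : AEStronglyMeasurable f₀ μ := by
    have h1 : AEStronglyMeasurable (fun r : ℝ => ((r : ℂ) ^ M)⁻¹) μ :=
      ((Complex.measurable_ofReal.pow_const M).inv).aestronglyMeasurable
    refine (hf.1.mul h1).congr ?_
    filter_upwards [h0] with r hr
    have : (r : ℂ) ≠ 0 := Complex.ofReal_ne_zero.2 hr.ne'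
    simp only [Pi.mul_apply]
    field_simp
  rw [memLp_two_iff_integrable_sq_norm (hm.mono_ac (withDensity_absolutelyContinuous _ _)),
    integrable_withDensity_iff_integrable_smul' (by fun_prop) (by simp)]
  rw [memLp_two_iff_integrable_sq_norm hf.1] at hf
  refine hf.congr (.of_forall fun r => ?_)
  simp only
  rw [ENNReal.toReal_ofReal (sq_nonneg _), norm_mul, mul_pow, norm_pow, Complex.norm_real,
    Real.norm_eq_abs, smul_eq_mul, ← abs_pow, sq_abs, mul_comm]

/-- Otherwise homogeneity and continuity make `Y` vanish on all of `ℝⁿ`, and a complex polynomial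
vanishing at all real points is zero. -/
lemma exists_sphere_evalAt_ne_zero [NeZero n] {Y : MvPolynomial (Fin n) ℂ} {M : ℕ}
    (hY : Y.IsHomogeneous M) (hY0 : Y ≠ 0) :
    ∃ ω : Metric.sphere (0 : EuclideanSpace ℝ (Fin n)) 1, evalAt Y ω ≠ 0 := by
  by_contra! h
  have h1 : ∀ x : EuclideanSpace ℝ (Fin n), x ≠ 0 → evalAt Y x = 0 := by
    intro x hx
    have hx' : ‖x‖ ≠ 0 := norm_ne_zero_iff.2 hx
    have h2 : x = ‖x‖ • (‖x‖⁻¹ • x) := by rw [smul_smul, mul_inv_cancel₀ hx', one_smul]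
    rw [h2, evalAt_smul hY, h ⟨‖x‖⁻¹ • x, by simp [norm_smul, hx']⟩, mul_zero]
  have h2 : evalAt Y = fun _ => 0 :=
    (continuous_evalAt Y).ext_on (dense_compl_singleton (0 : EuclideanSpace ℝ (Fin n)))
      continuous_const fun x hx => h1 x hx
  refine hY0 (MvPolynomial.funext_set (fun _ => Set.range ((↑) : ℝ → ℂ))
    (fun _ => Set.infinite_range_of_injective Complex.ofReal_injective) fun z hz => ?_)
  choose x hx using fun i => hz i (Set.mem_univ i)
  have h3 := congrFun h2 (WithLp.toLp 2 x)
  rw [map_zero, ← h3, evalAt]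
  exact congrArg (fun w => MvPolynomial.eval w Y) (funext fun i => (hx i).symm)

lemma memLp_radial [NeZero n] {Y : MvPolynomial (Fin n) ℂ} {M : ℕ}
    (hY : Y.IsHomogeneous M) (hY0 : Y ≠ 0) {f₀ : ℝ → ℂ} {f : EuclideanSpace ℝ (Fin n) → ℂ}
    (hf : MemLp f 2 volume) (hff₀ : ∀ᵐ x, f x = f₀ ‖x‖ * evalAt Y x) :
    MemLp f₀ 2 (laguerreMeasure ((n : ℝ) / 2 - 1 + M)) := by
  have hpol := measurePreserving_polar (volume : Measure (EuclideanSpace ℝ (Fin n)))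
  rw [finrank_euclideanSpace_fin] at hpol
  have hg := hf.comp_measurePreserving hpol
  have h1 := hg.1.prodMk_left
  have h2 := ((memLp_two_iff_integrable_sq_norm hg.1).1 hg).prod_right_ae
  have h3 := Measure.ae_ae_of_ae_prod (hpol.quasiMeasurePreserving.ae hff₀)
  obtain ⟨ω₀, hω₀⟩ := exists_sphere_evalAt_ne_zero hY hY0
  have h4 : ∃ᵐ ω : Metric.sphere (0 : EuclideanSpace ℝ (Fin n)) 1 ∂(volume : Measure (EuclideanSpace ℝ (Fin n))).toSphere,
      evalAt Y (ω : EuclideanSpace ℝ (Fin n)) ≠ 0 := by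
    rw [frequently_ae_iff]
    refine IsOpen.measure_ne_zero _ ?_ ⟨ω₀, hω₀⟩
    exact isOpen_ne_fun ((continuous_evalAt Y).comp continuous_subtype_val) continuous_const
  -- The set `Y ≠ 0` is open and nonempty on the sphere, hence of positive measure, so it meets the
  -- full-measure set of rays along which `f` is square integrable and has the given form.
  obtain ⟨ω, hω, hω1, hω2, hω3⟩ := (h4.and_eventually (h1.and (h2.and h3))).exists
  have h5 : MemLp (fun r : Set.Ioi (0 : ℝ) => f ((r : ℝ) • (ω : EuclideanSpace ℝ (Fin n)))) 2
      (Measure.volumeIoiPow (n - 1)) := (memLp_two_iff_integrable_sq_norm hω1).2 hω2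
  rw [laguerreMeasure_eq]
  have hemb : MeasurableEmbedding (Subtype.val : Set.Ioi (0 : ℝ) → ℝ) :=
    MeasurableEmbedding.subtype_coe measurableSet_Ioi
  refine memLp_withDensity_of_memLp_mul M ?_ ?_
  · rw [hemb.ae_map_iff]
    exact .of_forall fun r => r.2
  · rw [hemb.memLp_map_measure_iff]
    refine (h5.const_mul (evalAt Y ω)⁻¹).ae_eq ?_
    filter_upwards [hω3] with r hr
    have hr0 : (0 : ℝ) < r := r.2
    simp only [Function.comp_apply]
    rw [hr, norm_smul, norm_eq_of_mem_sphere, mul_one, Real.norm_of_nonneg hr0.le,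
      evalAt_smul hY]
    field_simp

end

end HeckeBochner

theorem theorem3p2 (n : ℕ) (hn : 1 ≤ n) (M : ℕ) (Y : MvPolynomial (Fin n) ℂ)
    (hY : HeckeBochner.IsSolidHarmonic M Y)
    (f₀ : ℝ → ℂ) (f : EuclideanSpace ℝ (Fin n) → ℂ)
    (hf : MemLp f 2 volume)
    (hff₀ : ∀ᵐ x : EuclideanSpace ℝ (Fin n), f x = f₀ ‖x‖ * HeckeBochner.evalAt Y x) :
    (Y ≠ 0 → MemLp f₀ 2 (HeckeBochner.laguerreMeasure ((n : ℝ) / 2 - 1 + M))) ∧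
    (∀ (K : ℕ) (x : EuclideanSpace ℝ (Fin n)),
      HeckeBochner.hermiteProjection (M + 2 * K) f x =
        HeckeBochner.laguerreCoeff ((n : ℝ) / 2 - 1 + M) K f₀ *
          (HeckeBochner.laguerreFunction ((n : ℝ) / 2 - 1 + M) K ‖x‖ : ℂ) *
          HeckeBochner.evalAt Y x) ∧
    (∀ m : ℕ, (¬ ∃ K : ℕ, m = M + 2 * K) →
      ∀ x : EuclideanSpace ℝ (Fin n), HeckeBochner.hermiteProjection m f x = 0) := by
  have : NeZero n := ⟨by omega⟩
  have hae : ∀ α : Fin n → ℕ, (fun x => f x * (HeckeBochner.hermiteFunction α x : ℂ)) =ᵐ[volume]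
      fun x => f₀ ‖x‖ * HeckeBochner.evalAt Y x * (HeckeBochner.hermiteFunction α x : ℂ) :=
    fun α => hff₀.mono fun x hx => by simp only [hx]
  have hint : ∀ α : Fin n → ℕ, Integrable fun x : EuclideanSpace ℝ (Fin n) =>
      f₀ ‖x‖ * HeckeBochner.evalAt Y x * (HeckeBochner.hermiteFunction α x : ℂ) :=
    fun α => (hf.integrable_mul (HeckeBochner.memLp_hermiteFunction α)).congr (hae α)
  refine ⟨fun hY0 => HeckeBochner.memLp_radial hY.1 hY0 hf hff₀, fun K x => ?_, fun m hm x => ?_⟩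
  -- With the right side expanded in Hermite functions, the two sums over `|α| = M + 2K` agree term
  -- by term.
  · rw [mul_assoc, HeckeBochner.laguerreFunction_mul_eq_sum hY, Finset.mul_sum,
      HeckeBochner.hermiteProjection]
    refine Finset.sum_congr rfl fun α hα => ?_
    rw [integral_congr_ae (hae α), HeckeBochner.integral_radial_mul_hermiteFunction_eq hY α
      (Finset.mem_piAntidiag.1 hα).1 f₀ (hint α), mul_assoc]
  · refine Finset.sum_eq_zero fun α hα => ?_
    rw [integral_congr_ae (hae α), HeckeBochner.integral_radial_mul_hermiteFunction_eq_zero hY α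
      (fun K hK => hm ⟨K, (Finset.mem_piAntidiag.1 hα).1.symm.trans hK⟩) f₀ (hint α), zero_mul]
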